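/- Let $\mathbb H^3$ be hyperbolic space in the ball model, that is, the unit ball $\{|x|<1\}\subset\mathbb R^3$ with the metric $ds^2_{\mathbb H^3}=\frac{4|dx|^2}{(1-|x|^2)^2}=d\rho^2+\sinh^2\!\rho\,d\sigma^2$, where $\rho(x)=\log\frac{1+|x|}{1-|x|}$ is the hyperbolic distance to the centre $0$ and $d\sigma^2$ is the standard metric of $\mathbb S^2$. For $s>0$ let $B_s=\{\rho<s\}$ be the open geodesic ball of radius $s$ about $0$. The anti-de Sitter–Schwarzschild metric $g_{\mathrm{AdS\text{-}Sch},M}$ of mass $M>0$ is defined as follows. Let $a=a(M)$ be the unique positive root of $1+r^2-\frac Mr=0$, and for $r\ge a$ put $$h(r)=\int_r^\infty\frac{dt}{\sqrt{t(t+t^3-M)}},\qquad \rho(r)=\log\coth\frac{h(r)}2 .$$ Let $r(\rho)$, $\rho\ge\rho(a)$, be the inverse of this increasing function, let $\phi>0$ be given by $\phi(\rho)^4=r(\rho)^2/\sinh^2\rho$, and put $b=\frac{e^{\rho(a)}-1}{e^{\rho(a)}+1}$ and $\psi(\tau)=\phi\bigl(\log\frac{1+\tau}{1-\tau}\bigr)$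 for $b\le\tau<1$. With $$f_M(\tau)=\begin{cases}\psi(\tau), & b\le\tau<1,\\ b\,\psi(b^2/\tau)\left(\dfrac{1-\tau^2}{\tau^2-b^4}\right)^{1/2}, & b^2<\tau<b,\end{cases}$$ the metric is $g_{\mathrm{AdS\text{-}Sch},M}=f_M(|x|)^4\,ds^2_{\mathbb H^3}$ on $\{b^2<|x|<1\}=\{\rho>\rho_0(M)\}$, where $\rho_0(M)=\log\frac{1+b^2}{1-b^2}$. **Corollary.** Let $\rho_*>0$ and let $g=\phi^4ds^2_{\mathbb H^3}$ be a metric on $\mathbb H^3\setminus B_{\rho_*}$ conformal to the hyperbolic metric, where $\phi$ is continuous on $\mathbb H^3\setminus B_{\rho_*}$ and of class $C^2$ on its interior $\{\rho>\rho_*\}$. Suppose that $g$ has scalar curvature $-6$ on $\{\rho>\rho_*\}$, that $\phi>1$ on $\mathbb H^3\setminus B_{\rho_*}$, that $\phi(x)\to1$ as $\rho(x)\to\infty$, and that $\phi$ is constant on $\partial B_{\rho_*}$. Then there is $M>0$ such that $\rho_0(M)<\rho_*$ and $g=g_{\mathrm{AdS\text{-}Sch},M}$ on $\mathbb H^3\setminus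 B_{\rho_*}$. -/

import Mathlib

noncomputable section

namespace AdSSch

/-- Coordinate space of dimension `n`, with the Euclidean norm. -/
abbrev Space (n : ℕ) : Type := EuclideanSpace ℝ (Fin n)

/-- A field of matrices `x ↦ (g_{ij}(x))`: the coefficients of a metric in the standard
coordinates of an open subset of `ℝⁿ`. -/
abbrev MetricField (n : ℕ) : Type := Space n → Matrix (Fin n) (Fin n) ℝ

/-! ### Scalar curvature in coordinates -/

/-- The partial derivative `∂f/∂xᵢ`. -/
def partialDeriv {n : ℕ} (i : Fin n) (f : Space n → ℝ) (x : Space n) : ℝ :=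
  fderiv ℝ f x (EuclideanSpace.single i 1)

/-- The Christoffel symbol
`Γᵏ_{ij} = ½ ∑ₗ gᵏˡ (∂ᵢ g_{jl} + ∂ⱼ g_{il} - ∂ₗ g_{ij})`. -/
def christoffel {n : ℕ} (g : MetricField n) (k i j : Fin n) (x : Space n) : ℝ :=
  (1 / 2 : ℝ) * ∑ l : Fin n, (g x)⁻¹ k l *
    (partialDeriv i (fun y => g y j l) x + partialDeriv j (fun y => g y i l) x
      - partialDeriv l (fun y => g y i j) x)

/-- The Ricci tensor
`R_{ij} = ∑ₖ (∂ₖ Γᵏ_{ij} - ∂ⱼ Γᵏ_{ik}) + ∑ₖₗ (Γᵏ_{kl} Γˡ_{ij} - Γᵏ_{jl} Γˡ_{ik})`. -/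
def ricci {n : ℕ} (g : MetricField n) (i j : Fin n) (x : Space n) : ℝ :=
  (∑ k : Fin n, (partialDeriv k (christoffel g k i j) x
      - partialDeriv j (christoffel g k i k) x))
    + ∑ k : Fin n, ∑ l : Fin n,
        (christoffel g k k l x * christoffel g l i j x
          - christoffel g k j l x * christoffel g l i k x)

/-- The scalar curvature `R = ∑ᵢⱼ gⁱʲ R_{ij}`. -/
def scalarCurvature {n : ℕ} (g : MetricField n) (x : Space n) : ℝ :=
  ∑ i : Fin n, ∑ j : Fin n, (g x)⁻¹ i j * ricci g i j x

/-! ### Hyperbolic 3-space in the ball model -/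

/-- The underlying set of the ball model of `ℍ³`: the open Euclidean unit ball. -/
def hypBall : Set (Space 3) := Metric.ball 0 1

/-- The hyperbolic metric `4 (1 - |x|²)⁻² |dx|²` of curvature `-1`. -/
def hypMetric : MetricField 3 := fun x =>
  (4 / (1 - ‖x‖ ^ 2) ^ 2) • (1 : Matrix (Fin 3) (Fin 3) ℝ)

/-- The geodesic distance in the ball model from the centre to a point at Euclidean distance `τ`
from it, `0 ≤ τ < 1`. -/
def radiusOf (τ : ℝ) : ℝ := Real.log ((1 + τ) / (1 - τ))

/-- The geodesic polar coordinate on `ℍ³`: the hyperbolic distance from `0` to `x`. -/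
def hypRadius (x : Space 3) : ℝ := radiusOf ‖x‖

/-- `ℍ³ \ B_ρ₀`, where `B_ρ₀` is the open geodesic ball of radius `ρ₀` about `0`. -/
def exterior (ρ₀ : ℝ) : Set (Space 3) := {x | x ∈ hypBall ∧ ρ₀ ≤ hypRadius x}

/-- The interior of `ℍ³ \ B_ρ₀`. -/
def exteriorInterior (ρ₀ : ℝ) : Set (Space 3) := {x | x ∈ hypBall ∧ ρ₀ < hypRadius x}

/-- The geodesic sphere of radius `ρ₀` about `0`, that is, the boundary of `ℍ³ \ B_ρ₀`. -/
def geodesicSphere (ρ₀ : ℝ) : Set (Space 3) := {x | x ∈ hypBall ∧ hypRadius x = ρ₀}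

/-- The filter `x → ∞` in `ℍ³`: hyperbolic distance from `0` tends to infinity. -/
def atInfinity : Filter (Space 3) :=
  Filter.comap hypRadius Filter.atTop ⊓ Filter.principal hypBall

/-- The metric `φ⁴ ds²` conformal to the hyperbolic metric `ds²`. -/
def conformalMetric (φ : Space 3 → ℝ) : MetricField 3 := fun x => φ x ^ 4 • hypMetric x

/-! ### The anti-de Sitter-Schwarzschild metric of mass `M > 0` -/

/-- `a(M)`: the unique positive root of `1 + r² - M / r = 0`. -/
def horizonRadius (M : ℝ) : ℝ := sInf {r : ℝ | 0 < r ∧ 1 + r ^ 2 - M / r = 0}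

/-- `h(r) = ∫_r^∞ dt / √(t (t + t³ - M))`, for `r ≥ a(M)`. -/
def hFun (M r : ℝ) : ℝ := ∫ t in Set.Ioi r, 1 / Real.sqrt (t * (t + t ^ 3 - M))

/-- `ρ(r) = log coth (h(r) / 2)`, for `r ≥ a(M)`. -/
def rhoFun (M r : ℝ) : ℝ :=
  Real.log (Real.cosh (hFun M r / 2) / Real.sinh (hFun M r / 2))

/-- `ρ(M) = ρ(a(M))`. -/
def horizonRho (M : ℝ) : ℝ := rhoFun M (horizonRadius M)

/-- `r(ρ)`, for `ρ ≥ ρ(M)`: the inverse of the increasing function `r ↦ ρ(r)` on `[a(M), ∞)`. -/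
def rFun (M ρ : ℝ) : ℝ := Function.invFunOn (rhoFun M) (Set.Ici (horizonRadius M)) ρ

/-- The conformal factor outside the horizon, `φ > 0` with `φ⁴ = r(ρ)² / sinh² ρ`, for
`ρ ≥ ρ(M)`. -/
def phiOuter (M ρ : ℝ) : ℝ := Real.sqrt (rFun M ρ / Real.sinh ρ)

/-- `b(M)`: the Euclidean radius of the horizon in the ball model. -/
def bFun (M : ℝ) : ℝ := (Real.exp (horizonRho M) - 1) / (Real.exp (horizonRho M) + 1)

/-- `ψ(τ) = φ(log ((1 + τ) / (1 - τ)))`, for `b(M) ≤ τ < 1`. -/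
def psiFun (M τ : ℝ) : ℝ := phiOuter M (radiusOf τ)

/-- The conformal factor of the doubled metric as a function of `τ = |x| ∈ (b(M)², 1)`: on
`b² < τ < b` the metric is the pull back of the one on `b < τ < 1` by `x ↦ b² x / |x|²`. -/
def fFun (M τ : ℝ) : ℝ :=
  if bFun M ≤ τ then psiFun M τ
  else bFun M * psiFun M (bFun M ^ 2 / τ) * Real.sqrt ((1 - τ ^ 2) / (τ ^ 2 - bFun M ^ 4))

/-- `ρ₀(M) = log ((1 + b(M)²) / (1 - b(M)²))`: the metric of mass `M` lives on the set
`ρ > ρ₀(M)` of `ℍ³`. -/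
def innerRho (M : ℝ) : ℝ := radiusOf (bFun M ^ 2)

/-- The anti-de Sitter-Schwarzschild metric of mass `M`, on `exteriorInterior (innerRho M)`. -/
def adsSchMetric (M : ℝ) : MetricField 3 := conformalMetric (fun x => fFun M ‖x‖)

end AdSSch

end

open Filter Topology

namespace AdSSch

/-! Write `g = exp (2 f) |dx|²`. Scalar curvature `-6` means `2 Δf + |∇f|² = 3 exp (2 f)`. At an
interior maximum of the difference of two solutions the gradients agree and the Laplacians are
ordered, so the exponentials are ordered and the maximum is at most `0`. Hence positive conformal
factors with equal values on the sphere and limit `1` at infinity coincide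
(`le_of_solvesLiouville`). It remains to find an anti-de Sitter-Schwarzschild metric whose factor on
the sphere is the given constant `c > 1`.

Put `s = -log |x|` and let `Y(s)` be the reciprocal of the area radius. A radial metric is `Y⁻² (ds²
+ dσ²)`, its factor satisfies `φ² = sinh s / Y`, and mass `M` means `Y'² = 1 + Y² - M Y³`; the
hyperbolic metric is `Y = sinh s`. So some positive mass must satisfy `Y(s₀) = sinh s₀ / c²`, a
value below `sinh s₀`; this is `exists_travel_eq`.

The square root of the cubic vanishes at the horizon. The substitution `Y = A (1 - v²)`, with `1 /
A` the horizon radius, removes this singularity: `v > 0` is outside the horizon, `v < 0` inside, and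
`s = travel A v` is smooth and strictly decreasing in `v`. In these terms both branches of `fFun`
become one formula (`fFun_massOf`), which solves the equation across the horizon
(`solvesLiouville_profile`). -/

/-! ### Scalar curvature of a conformally flat metric -/

/-- `f` is differentiable near `x` and its partial derivatives are differentiable at `x`. -/
def TwiceDiffAt {n : ℕ} (f : Space n → ℝ) (x : Space n) : Prop :=
  (∀ᶠ y in 𝓝 x, DifferentiableAt ℝ f y) ∧ ∀ i, DifferentiableAt ℝ (partialDeriv i f) x

theorem partialDeriv_congr {n : ℕ} {f h : Space n → ℝ} {x : Space n} (i : Fin n)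
    (hfh : f =ᶠ[𝓝 x] h) : partialDeriv i f x = partialDeriv i h x := by
  unfold partialDeriv
  rw [hfh.fderiv_eq]

theorem partialDeriv_eventuallyEq {n : ℕ} {f h : Space n → ℝ} {x : Space n} (i : Fin n)
    (hfh : f =ᶠ[𝓝 x] h) : partialDeriv i f =ᶠ[𝓝 x] partialDeriv i h :=
  hfh.eventuallyEq_nhds.mono fun _ hy => partialDeriv_congr i hy

theorem TwiceDiffAt.congr {n : ℕ} {f h : Space n → ℝ} {x : Space n} (hf : TwiceDiffAt f x)
    (hfh : f =ᶠ[𝓝 x] h) : TwiceDiffAt h x := by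
  refine ⟨?_, fun i => ?_⟩
  · filter_upwards [hf.1, hfh.eventuallyEq_nhds] with y hy hy'
    exact hy'.differentiableAt_iff.1 hy
  · exact (partialDeriv_eventuallyEq i hfh).differentiableAt_iff.1 (hf.2 i)

theorem TwiceDiffAt.of_contDiffAt {n : ℕ} {f : Space n → ℝ} {x : Space n}
    (hf : ContDiffAt ℝ 2 f x) : TwiceDiffAt f x := by
  refine ⟨?_, fun i => ?_⟩
  · filter_upwards [hf.eventually (by simp)] with y hy
    exact hy.differentiableAt (by norm_num)
  · have h1 : ContDiffAt ℝ 1 (fderiv ℝ f) x := hf.fderiv_right (by norm_num)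
    exact (h1.differentiableAt (by norm_num)).clm_apply (differentiableAt_const _)

theorem TwiceDiffAt.sub {n : ℕ} {f h : Space n → ℝ} {x : Space n} (hf : TwiceDiffAt f x)
    (hh : TwiceDiffAt h x) : TwiceDiffAt (fun y => f y - h y) x ∧
      (∀ i, partialDeriv i (fun y => f y - h y) x = partialDeriv i f x - partialDeriv i h x) ∧
      ∀ i, partialDeriv i (partialDeriv i (fun y => f y - h y)) x =
        partialDeriv i (partialDeriv i f) x - partialDeriv i (partialDeriv i h) x := by
  have key : ∀ i, partialDeriv i (fun y => f y - h y) =ᶠ[𝓝 x]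
      fun y => partialDeriv i f y - partialDeriv i h y := by
    intro i
    filter_upwards [hf.1, hh.1] with y h1 h2
    unfold partialDeriv
    rw [fderiv_fun_sub h1 h2]
    rfl
  refine ⟨⟨?_, fun i => ?_⟩, fun i => (key i).eq_of_nhds, fun i => ?_⟩
  · filter_upwards [hf.1, hh.1] with y h1 h2 using h1.sub h2
  · exact (key i).differentiableAt_iff.2 ((hf.2 i).sub (hh.2 i))
  · rw [partialDeriv_congr i (key i)]
    exact congrArg (fun L => L (EuclideanSpace.single i 1)) (fderiv_fun_sub (hf.2 i) (hh.2 i))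

theorem partialDeriv_exp_metric {n : ℕ} {g : MetricField n} {f : Space n → ℝ} {x : Space n}
    (hg : ∀ᶠ y in 𝓝 x, g y = Real.exp (2 * f y) • (1 : Matrix (Fin n) (Fin n) ℝ))
    (hf : DifferentiableAt ℝ f x) (a b c : Fin n) :
    partialDeriv a (fun y => g y b c) x =
      if b = c then 2 * Real.exp (2 * f x) * partialDeriv a f x else 0 := by
  have h1 : (fun y => g y b c) =ᶠ[𝓝 x]
      fun y => Real.exp (2 * f y) * (if b = c then 1 else 0) := by
    filter_upwards [hg] with y hy
    rw [hy]
    simp [Matrix.one_apply]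
  rw [partialDeriv_congr a h1]
  split_ifs with hbc
  · simp only [mul_one]
    unfold partialDeriv
    rw [((hf.hasFDerivAt.const_mul 2).exp).fderiv]
    simp
    ring
  · unfold partialDeriv
    simp

theorem christoffel_exp_metric {n : ℕ} {g : MetricField n} {f : Space n → ℝ} {x : Space n}
    (hg : ∀ᶠ y in 𝓝 x, g y = Real.exp (2 * f y) • (1 : Matrix (Fin n) (Fin n) ℝ))
    (hf : DifferentiableAt ℝ f x) (k i j : Fin n) :
    christoffel g k i j x =
      (if j = k then 1 else 0) * partialDeriv i f x + (if i = k then 1 else 0) * partialDeriv j f x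
        - (if i = j then 1 else 0) * partialDeriv k f x := by
  have hinv : (g x)⁻¹ = (Real.exp (2 * f x))⁻¹ • (1 : Matrix (Fin n) (Fin n) ℝ) := by
    apply Matrix.inv_eq_right_inv
    rw [hg.self_of_nhds]
    simp [smul_smul]
  unfold christoffel
  simp only [partialDeriv_exp_metric hg hf, hinv, Matrix.smul_apply, Matrix.one_apply, smul_eq_mul,
    mul_ite, mul_one, mul_zero, ite_mul, zero_mul]
  rw [Finset.sum_ite_eq Finset.univ k]
  simp only [Finset.mem_univ, if_true]
  have := Real.exp_ne_zero (2 * f x)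
  split_ifs <;> field_simp <;> ring

/-- The inverse metric is diagonal, so the contraction leaves only pure second derivatives: symmetry
of mixed partials is not needed, and `TwiceDiffAt` is enough regularity. -/
theorem scalarCurvature_exp_metric {g : MetricField 3} {f : Space 3 → ℝ} {x : Space 3}
    (hg : ∀ᶠ y in 𝓝 x, g y = Real.exp (2 * f y) • (1 : Matrix (Fin 3) (Fin 3) ℝ))
    (hf : TwiceDiffAt f x) :
    scalarCurvature g x = -Real.exp (-(2 * f x)) *
      (4 * ∑ i, partialDeriv i (partialDeriv i f) x + 2 * ∑ i, partialDeriv i f x ^ 2) := by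
  have hinv : (g x)⁻¹ = Real.exp (-(2 * f x)) • (1 : Matrix (Fin 3) (Fin 3) ℝ) := by
    apply Matrix.inv_eq_right_inv
    rw [hg.self_of_nhds]
    simp [smul_smul, ← Real.exp_add]
  have hchr : ∀ k i j, christoffel g k i j =ᶠ[𝓝 x] fun y =>
      (if j = k then 1 else 0) * partialDeriv i f y + (if i = k then 1 else 0) * partialDeriv j f y
        - (if i = j then 1 else 0) * partialDeriv k f y := by
    intro k i j
    filter_upwards [hg.eventually_nhds, hf.1] with y h1 h2
    exact christoffel_exp_metric h1 h2 k i j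
  have hder : ∀ a k i j, partialDeriv a (christoffel g k i j) x =
      (if j = k then 1 else 0) * partialDeriv a (partialDeriv i f) x
        + (if i = k then 1 else 0) * partialDeriv a (partialDeriv j f) x
        - (if i = j then 1 else 0) * partialDeriv a (partialDeriv k f) x := by
    intro a k i j
    rw [partialDeriv_congr a (hchr k i j)]
    have h := ((((hf.2 i).hasFDerivAt.const_mul (if j = k then (1 : ℝ) else 0)).add
      ((hf.2 j).hasFDerivAt.const_mul (if i = k then (1 : ℝ) else 0))).sub
      ((hf.2 k).hasFDerivAt.const_mul (if i = j then (1 : ℝ) else 0))).fderiv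
    conv_lhs => unfold partialDeriv
    refine (congrArg (fun L => L (EuclideanSpace.single a 1)) h).trans ?_
    split_ifs <;> simp [partialDeriv]
  unfold scalarCurvature ricci
  simp only [hder, (hchr _ _ _).eq_of_nhds, hinv, Fin.sum_univ_three, Matrix.smul_apply,
    Matrix.one_apply, smul_eq_mul]
  simp [Fin.ext_iff]
  ring

/-! ### The comparison principle -/

theorem hasDerivAt_line {n : ℕ} {f : Space n → ℝ} {x : Space n} (i : Fin n) {t : ℝ}
    (hf : DifferentiableAt ℝ f (x + t • EuclideanSpace.single i 1)) :
    HasDerivAt (fun t : ℝ => f (x + t • EuclideanSpace.single i 1))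
      (partialDeriv i f (x + t • EuclideanSpace.single i 1)) t := by
  have h1 : HasDerivAt (fun t : ℝ => x + t • (EuclideanSpace.single i 1 : Space n))
      (EuclideanSpace.single i 1) t := by
    simpa using ((hasDerivAt_id t).smul_const (EuclideanSpace.single i 1 : Space n)).const_add x
  exact hf.hasFDerivAt.comp_hasDerivAt t h1

/-- Were the second derivative along the coordinate line positive, the second derivative test would
make the point a local minimum as well. The restriction would then be locally constant, with second
derivative zero. -/
theorem IsLocalMax.partialDeriv_partialDeriv_nonpos {n : ℕ} {f : Space n → ℝ} {x : Space n}
    (hmax : IsLocalMax f x) (hf : TwiceDiffAt f x) (i : Fin n) :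
    partialDeriv i (partialDeriv i f) x ≤ 0 := by
  by_contra hpos
  push Not at hpos
  set ℓ : ℝ → Space n := fun t => x + t • EuclideanSpace.single i 1 with hℓ
  have hℓ0 : ℓ 0 = x := by simp [hℓ]
  have hℓc : Tendsto ℓ (𝓝 0) (𝓝 x) := by
    have : Continuous ℓ := by fun_prop
    simpa [hℓ0] using this.tendsto 0
  have hd : ∀ᶠ t in 𝓝 (0 : ℝ), HasDerivAt (fun t => f (ℓ t)) (partialDeriv i f (ℓ t)) t :=
    (hℓc.eventually hf.1).mono fun t ht => hasDerivAt_line i ht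
  have hd1 : deriv (fun t => f (ℓ t)) =ᶠ[𝓝 0] fun t => partialDeriv i f (ℓ t) :=
    hd.mono fun t ht => ht.deriv
  have hd2 : HasDerivAt (fun t => partialDeriv i f (ℓ t))
      (partialDeriv i (partialDeriv i f) x) 0 := by
    have := hasDerivAt_line (f := partialDeriv i f) (x := x) i (t := 0) (by simpa using hf.2 i)
    simpa [hℓ] using this
  have hmaxℓ : IsLocalMax (fun t => f (ℓ t)) 0 := by
    have := hℓc.eventually hmax
    simpa [IsLocalMax, IsMaxFilter, hℓ0] using this
  have h2 : deriv (deriv fun t => f (ℓ t)) 0 = partialDeriv i (partialDeriv i f) x := by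
    rw [hd1.deriv_eq, hd2.deriv]
  have hmin : IsLocalMin (fun t => f (ℓ t)) 0 :=
    isLocalMin_of_deriv_deriv_pos (by rw [h2]; exact hpos) hmaxℓ.deriv_eq_zero
      hd.self_of_nhds.continuousAt
  have hconst : (fun t => f (ℓ t)) =ᶠ[𝓝 0] fun _ => f (ℓ 0) := by
    filter_upwards [hmaxℓ, hmin] with t h1 h2 using le_antisymm h1 h2
  have h3 : deriv (fun t => f (ℓ t)) =ᶠ[𝓝 0] fun _ => 0 := by
    simpa using hconst.deriv
  rw [h3.deriv_eq] at h2
  simp at h2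
  linarith

/-- The equation for `exp (2 f) |dx|²` to have scalar curvature `-6`. -/
def SolvesLiouville (f : Space 3 → ℝ) (x : Space 3) : Prop :=
  2 * ∑ i, partialDeriv i (partialDeriv i f) x + ∑ i, partialDeriv i f x ^ 2
    = 3 * Real.exp (2 * f x)

theorem SolvesLiouville.congr {f h : Space 3 → ℝ} {x : Space 3} (hf : SolvesLiouville f x)
    (hfh : f =ᶠ[𝓝 x] h) : SolvesLiouville h x := by
  unfold SolvesLiouville at hf ⊢
  simp only [← fun i => partialDeriv_congr i (partialDeriv_eventuallyEq i hfh),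
    ← fun i => partialDeriv_congr i hfh, ← hfh.eq_of_nhds]
  exact hf

/-- The gradient terms cancel at the maximum, and the right-hand side of the equation is increasing
in the unknown. -/
theorem SolvesLiouville.le_of_isLocalMax {f h : Space 3 → ℝ} {x : Space 3}
    (hf : TwiceDiffAt f x) (hh : TwiceDiffAt h x) (hf' : SolvesLiouville f x)
    (hh' : SolvesLiouville h x) (hmax : IsLocalMax (fun y => f y - h y) x) : f x ≤ h x := by
  obtain ⟨h1, h2, h3⟩ := hf.sub hh
  have hgrad : ∀ i, partialDeriv i f x = partialDeriv i h x := by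
    intro i
    have : partialDeriv i (fun y => f y - h y) x = 0 := by
      unfold partialDeriv
      rw [hmax.fderiv_eq_zero]
      rfl
    linarith [h2 i]
  have hsum : ∑ i, partialDeriv i (partialDeriv i f) x
      ≤ ∑ i, partialDeriv i (partialDeriv i h) x := by
    apply Finset.sum_le_sum
    intro i _
    have := IsLocalMax.partialDeriv_partialDeriv_nonpos hmax h1 i
    linarith [h3 i]
  unfold SolvesLiouville at hf' hh'
  simp only [hgrad] at hf'
  have : Real.exp (2 * f x) ≤ Real.exp (2 * h x) := by linarith
  linarith [Real.exp_le_exp.1 this]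

/-! ### The ball model -/

theorem mem_hypBall {x : Space 3} : x ∈ hypBall ↔ ‖x‖ < 1 := by
  simp [hypBall]

theorem strictMonoOn_radiusOf : StrictMonoOn radiusOf (Set.Ioo (-1) 1) := by
  intro x hx y hy hxy
  unfold radiusOf
  have h1 : 0 < 1 - x := by linarith [hx.2]
  have h2 : 0 < 1 - y := by linarith [hy.2]
  apply Real.log_lt_log (div_pos (by linarith [hx.1]) h1)
  rw [div_lt_div_iff₀ h1 h2]
  nlinarith

theorem norm_mem_Ioo {x : Space 3} (hx : x ∈ hypBall) : ‖x‖ ∈ Set.Ioo (-1 : ℝ) 1 :=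
  ⟨by linarith [norm_nonneg x], mem_hypBall.1 hx⟩

/-- The Euclidean radius of the geodesic ball of radius `ρ` about `0`. -/
noncomputable def euclRadius (ρ : ℝ) : ℝ := (Real.exp ρ - 1) / (Real.exp ρ + 1)

theorem euclRadius_mem (ρ : ℝ) : euclRadius ρ ∈ Set.Ioo (-1 : ℝ) 1 := by
  have := Real.exp_pos ρ
  constructor
  · unfold euclRadius
    rw [lt_div_iff₀ (by linarith)]
    linarith
  · unfold euclRadius
    rw [div_lt_one (by linarith)]
    linarith

theorem euclRadius_pos {ρ : ℝ} (hρ : 0 < ρ) : 0 < euclRadius ρ := by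
  have := Real.one_lt_exp_iff.2 hρ
  exact div_pos (by linarith) (by linarith)

theorem radiusOf_euclRadius (ρ : ℝ) : radiusOf (euclRadius ρ) = ρ := by
  have h := Real.exp_pos ρ
  unfold radiusOf euclRadius
  rw [show (1 + (Real.exp ρ - 1) / (Real.exp ρ + 1)) / (1 - (Real.exp ρ - 1) / (Real.exp ρ + 1))
    = Real.exp ρ by field_simp; ring, Real.log_exp]

theorem euclRadius_radiusOf {τ : ℝ} (hτ : τ ∈ Set.Ioo (-1 : ℝ) 1) : euclRadius (radiusOf τ) = τ :=
  strictMonoOn_radiusOf.injOn (euclRadius_mem _) hτ (radiusOf_euclRadius _)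

theorem mem_exterior {ρ : ℝ} {x : Space 3} :
    x ∈ exterior ρ ↔ euclRadius ρ ≤ ‖x‖ ∧ ‖x‖ < 1 := by
  constructor
  · rintro ⟨h1, h2⟩
    refine ⟨?_, mem_hypBall.1 h1⟩
    rwa [← strictMonoOn_radiusOf.le_iff_le (euclRadius_mem _) (norm_mem_Ioo h1),
      radiusOf_euclRadius]
  · rintro ⟨h1, h2⟩
    refine ⟨mem_hypBall.2 h2, ?_⟩
    rwa [← strictMonoOn_radiusOf.le_iff_le (euclRadius_mem _) (norm_mem_Ioo (mem_hypBall.2 h2)),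
      radiusOf_euclRadius] at h1

theorem mem_exteriorInterior {ρ : ℝ} {x : Space 3} :
    x ∈ exteriorInterior ρ ↔ euclRadius ρ < ‖x‖ ∧ ‖x‖ < 1 := by
  constructor
  · rintro ⟨h1, h2⟩
    refine ⟨?_, mem_hypBall.1 h1⟩
    rwa [← strictMonoOn_radiusOf.lt_iff_lt (euclRadius_mem _) (norm_mem_Ioo h1),
      radiusOf_euclRadius]
  · rintro ⟨h1, h2⟩
    refine ⟨mem_hypBall.2 h2, ?_⟩
    rwa [← strictMonoOn_radiusOf.lt_iff_lt (euclRadius_mem _) (norm_mem_Ioo (mem_hypBall.2 h2)),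
      radiusOf_euclRadius] at h1

theorem isOpen_exteriorInterior (ρ : ℝ) : IsOpen (exteriorInterior ρ) := by
  have : exteriorInterior ρ = {x | euclRadius ρ < ‖x‖} ∩ {x | ‖x‖ < 1} := by
    ext x
    exact mem_exteriorInterior
  rw [this]
  exact (isOpen_lt continuous_const continuous_norm).inter
    (isOpen_lt continuous_norm continuous_const)

theorem exteriorInterior_subset (ρ : ℝ) : exteriorInterior ρ ⊆ exterior ρ :=
  fun _ hx => ⟨hx.1, hx.2.le⟩

theorem eventually_atInfinity {p : Space 3 → Prop} (hp : ∀ᶠ x in atInfinity, p x) :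
    ∃ R, ∀ x ∈ hypBall, R ≤ hypRadius x → p x := by
  unfold atInfinity at hp
  rw [eventually_inf_principal, eventually_comap] at hp
  obtain ⟨R, hR⟩ := eventually_atTop.1 hp
  exact ⟨R, fun x hx hRx => hR _ hRx x rfl hx⟩

/-- Half the logarithm of the factor of `φ⁴ ds²` relative to the flat metric. -/
noncomputable def confLog (φ : Space 3 → ℝ) (x : Space 3) : ℝ :=
  2 * Real.log (φ x) + Real.log (2 / (1 - ‖x‖ ^ 2))

theorem conformalMetric_eq_exp {φ : Space 3 → ℝ} {x : Space 3} (hφ : 0 < φ x) (hx : ‖x‖ < 1) :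
    conformalMetric φ x = Real.exp (2 * confLog φ x) • (1 : Matrix (Fin 3) (Fin 3) ℝ) := by
  have h : 0 < 1 - ‖x‖ ^ 2 := by nlinarith [norm_nonneg x]
  have h1 : Real.exp (2 * confLog φ x) = φ x ^ 4 * (4 / (1 - ‖x‖ ^ 2) ^ 2) := by
    rw [confLog, show 2 * (2 * Real.log (φ x) + Real.log (2 / (1 - ‖x‖ ^ 2)))
      = ((4 : ℕ) : ℝ) * Real.log (φ x) + ((2 : ℕ) : ℝ) * Real.log (2 / (1 - ‖x‖ ^ 2)) by
        push_cast; ring,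
      Real.exp_add, Real.exp_nat_mul, Real.exp_nat_mul, Real.exp_log hφ,
      Real.exp_log (by positivity), div_pow]
    norm_num
  rw [h1, conformalMetric, hypMetric, smul_smul]

theorem twiceDiffAt_confLog {φ : Space 3 → ℝ} {x : Space 3} (hφ : ContDiffAt ℝ 2 φ x)
    (hpos : 0 < φ x) (hx : ‖x‖ < 1) : TwiceDiffAt (confLog φ) x := by
  have h : 0 < 1 - ‖x‖ ^ 2 := by nlinarith [norm_nonneg x]
  apply TwiceDiffAt.of_contDiffAt
  unfold confLog
  refine (contDiffAt_const.mul (hφ.log hpos.ne')).add (ContDiffAt.log ?_ (by positivity))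
  exact contDiffAt_const.div (contDiffAt_const.sub (contDiff_norm_sq ℝ).contDiffAt) h.ne'

theorem solvesLiouville_confLog {φ : Space 3 → ℝ} {g : MetricField 3} {ρ : ℝ} {x : Space 3}
    (hg : Set.EqOn g (conformalMetric φ) (exteriorInterior ρ)) (hx : x ∈ exteriorInterior ρ)
    (hpos : ∀ y ∈ exteriorInterior ρ, 0 < φ y) (hd : TwiceDiffAt (confLog φ) x)
    (hscal : scalarCurvature g x = -6) : SolvesLiouville (confLog φ) x := by
  rw [scalarCurvature_exp_metric ?_ hd, Real.exp_neg] at hscal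
  · unfold SolvesLiouville
    have := Real.exp_pos (2 * confLog φ x)
    field_simp at hscal
    linarith
  · filter_upwards [(isOpen_exteriorInterior ρ).mem_nhds hx] with y hy
    rw [hg hy, conformalMetric_eq_exp (hpos y hy) (mem_exteriorInterior.1 hy).2]

/-- Comparison principle for conformal factors of metrics of scalar curvature `-6`. -/
theorem le_of_solvesLiouville {ρ : ℝ} {φ ψ : Space 3 → ℝ}
    (hφc : ContinuousOn φ (exterior ρ)) (hψc : ContinuousOn ψ (exterior ρ))
    (hφ : ∀ x ∈ exterior ρ, 0 < φ x) (hψ : ∀ x ∈ exterior ρ, 0 < ψ x)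
    (hφd : ∀ x ∈ exteriorInterior ρ, TwiceDiffAt (confLog φ) x)
    (hψd : ∀ x ∈ exteriorInterior ρ, TwiceDiffAt (confLog ψ) x)
    (hφs : ∀ x ∈ exteriorInterior ρ, SolvesLiouville (confLog φ) x)
    (hψs : ∀ x ∈ exteriorInterior ρ, SolvesLiouville (confLog ψ) x)
    (hbdry : ∀ x ∈ geodesicSphere ρ, φ x = ψ x)
    (hφl : Tendsto φ atInfinity (𝓝 1)) (hψl : Tendsto ψ atInfinity (𝓝 1)) :
    ∀ x ∈ exterior ρ, φ x ≤ ψ x := by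
  intro x hx
  by_contra hlt
  push Not at hlt
  set D : Space 3 → ℝ := fun y => confLog φ y - confLog ψ y with hD
  have hDeq : ∀ y, D y = 2 * (Real.log (φ y) - Real.log (ψ y)) := by
    intro y
    simp only [hD, confLog]
    ring
  have hDx : 0 < D x := by
    rw [hDeq]
    linarith [Real.log_lt_log (hψ x hx) hlt]
  have hDl : Tendsto D atInfinity (𝓝 0) := by
    have := ((hφl.log one_ne_zero).sub (hψl.log one_ne_zero)).const_mul 2
    simpa [← hDeq] using this
  -- Beyond radius `R` the difference stays below `D x`, so its maximum over the compact shell `K`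
  -- is not on the outer sphere; nor is it on the inner one, where `D = 0`.
  obtain ⟨R, hR⟩ := eventually_atInfinity (hDl.eventually_lt_const hDx)
  have hxR : hypRadius x < R := by
    by_contra! h
    exact lt_irrefl _ (hR x hx.1 h)
  set K : Set (Space 3) := {y | euclRadius ρ ≤ ‖y‖} ∩ Metric.closedBall 0 (euclRadius R) with hK
  have hKmem : ∀ y, y ∈ K ↔ y ∈ exterior ρ ∧ hypRadius y ≤ R := by
    intro y
    rw [mem_exterior]
    simp only [hK, Set.mem_inter_iff, Set.mem_ofPred_eq, mem_closedBall_zero_iff]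
    have hiff : ‖y‖ < 1 → (hypRadius y ≤ R ↔ ‖y‖ ≤ euclRadius R) := fun h1 => by
      rw [← strictMonoOn_radiusOf.le_iff_le (norm_mem_Ioo (mem_hypBall.2 h1)) (euclRadius_mem _),
        radiusOf_euclRadius]
      rfl
    constructor
    · rintro ⟨h1, h2⟩
      have h3 : ‖y‖ < 1 := h2.trans_lt (euclRadius_mem R).2
      exact ⟨⟨h1, h3⟩, (hiff h3).2 h2⟩
    · rintro ⟨⟨h1, h2⟩, h3⟩
      exact ⟨h1, (hiff h2).1 h3⟩
  have hKc : IsCompact K :=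
    (isCompact_closedBall _ _).inter_left (isClosed_le continuous_const continuous_norm)
  have hDc : ContinuousOn D K := by
    have h1 : ContinuousOn D (exterior ρ) := by
      have : ContinuousOn (fun y => 2 * (Real.log (φ y) - Real.log (ψ y))) (exterior ρ) :=
        continuousOn_const.mul ((hφc.log fun y hy => (hφ y hy).ne').sub
          (hψc.log fun y hy => (hψ y hy).ne'))
      exact this.congr fun y _ => hDeq y
    exact h1.mono fun y hy => ((hKmem y).1 hy).1
  obtain ⟨z, hzK, hz⟩ := hKc.exists_isMaxOn ⟨x, (hKmem x).2 ⟨hx, hxR.le⟩⟩ hDc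
  obtain ⟨hzE, hzR⟩ := (hKmem z).1 hzK
  have hxz : D x ≤ D z := hz ((hKmem x).2 ⟨hx, hxR.le⟩)
  have hzR' : hypRadius z < R := by
    by_contra! h
    exact absurd (hR z hzE.1 h) (not_lt.2 hxz)
  have hzI : z ∈ exteriorInterior ρ := by
    refine ⟨hzE.1, lt_of_le_of_ne hzE.2 fun h => ?_⟩
    have : D z = 0 := by
      rw [hDeq, hbdry z ⟨hzE.1, h.symm⟩]
      ring
    linarith
  have hmax : IsLocalMax D z := by
    refine hz.isLocalMax ?_
    have hzn : ‖z‖ < euclRadius R := by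
      rwa [← strictMonoOn_radiusOf.lt_iff_lt (norm_mem_Ioo hzE.1) (euclRadius_mem _),
        radiusOf_euclRadius]
    filter_upwards [(isOpen_exteriorInterior ρ).mem_nhds hzI,
      Metric.isOpen_ball.mem_nhds (mem_ball_zero_iff.2 hzn)] with y h1 h2
    exact ⟨(mem_exteriorInterior.1 h1).1.le, Metric.ball_subset_closedBall h2⟩
  have := SolvesLiouville.le_of_isLocalMax (hφd z hzI) (hψd z hzI) (hφs z hzI) (hψs z hzI) hmax
  have h0 : D z = confLog φ z - confLog ψ z := rfl
  linarith

/-! ### The radial profile -/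

/-- With `y = A (1 - w²)` and `M = (1 + A²) / A³`, one has
`w² (radialPoly A w) = 1 + y² - M y³`. -/
def radialPoly (A w : ℝ) : ℝ := 3 - 3 * w ^ 2 + w ^ 4 + A ^ 2 * (1 - w ^ 2) ^ 2

theorem radialPoly_pos (A w : ℝ) : 0 < radialPoly A w := by
  unfold radialPoly
  nlinarith [sq_nonneg (w ^ 2 - 3 / 2), sq_nonneg (A * (1 - w ^ 2))]

theorem sqrt_radialPoly_pos (A w : ℝ) : 0 < √(radialPoly A w) :=
  Real.sqrt_pos.2 (radialPoly_pos A w)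

/-- For this mass the cubic `1 + y² - M y³` vanishes at `y = A`. Since `A - y = A w²`, the factor
`w²` splits off and leaves a quartic with no real zero. -/
theorem sq_mul_radialPoly {A : ℝ} (hA : A ≠ 0) (w : ℝ) :
    w ^ 2 * radialPoly A w = 1 + (A * (1 - w ^ 2)) ^ 2
      - (1 + A ^ 2) / A ^ 3 * (A * (1 - w ^ 2)) ^ 3 := by
  unfold radialPoly
  field_simp
  ring

theorem continuous_radialIntegrand :
    Continuous fun p : ℝ × ℝ => 2 * p.1 / √(radialPoly p.1 p.2) := by
  apply Continuous.div (by fun_prop)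
  · unfold radialPoly
    fun_prop
  · exact fun p => (sqrt_radialPoly_pos _ _).ne'

theorem continuous_radialIntegrand_right (A : ℝ) :
    Continuous fun w : ℝ => 2 * A / √(radialPoly A w) :=
  continuous_radialIntegrand.comp (by fun_prop : Continuous fun w : ℝ => (A, w))

/-- The value of `-log |x|` at a point of the metric of mass `(1 + A²) / A³` where the area radius
is `1 / (A (1 - v²))`; negative `v` correspond to points inside the horizon. -/
noncomputable def travel (A v : ℝ) : ℝ := ∫ w in v..1, 2 * A / √(radialPoly A w)

theorem travel_eq_neg (A v : ℝ) :
    travel A v = -∫ w in (1 : ℝ)..v, 2 * A / √(radialPoly A w) :=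
  intervalIntegral.integral_symm _ _

theorem travel_one (A : ℝ) : travel A 1 = 0 := intervalIntegral.integral_same

theorem hasStrictDerivAt_travel (A v : ℝ) :
    HasStrictDerivAt (travel A) (-(2 * A / √(radialPoly A v))) v := by
  have := ((continuous_radialIntegrand_right A).integral_hasStrictDerivAt 1 v).fun_neg
  exact this.congr_of_eventuallyEq (Eventually.of_forall fun u => (travel_eq_neg A u).symm)

theorem continuous_travel : Continuous fun p : ℝ × ℝ => travel p.1 p.2 := by
  simp only [travel_eq_neg]
  refine (intervalIntegral.continuous_parametric_intervalIntegral_of_continuous ?_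
    continuous_snd).neg
  exact continuous_radialIntegrand.comp
    (by fun_prop : Continuous fun q : (ℝ × ℝ) × ℝ => (q.1.1, q.2))

theorem continuous_travel_right (A : ℝ) : Continuous (travel A) :=
  continuous_travel.comp (by fun_prop : Continuous fun w : ℝ => (A, w))

theorem travel_deriv_neg {A : ℝ} (hA : 0 < A) (v : ℝ) : -(2 * A / √(radialPoly A v)) < 0 := by
  have := sqrt_radialPoly_pos A v
  have : 0 < 2 * A / √(radialPoly A v) := by positivity
  linarith

theorem strictAnti_travel {A : ℝ} (hA : 0 < A) : StrictAnti (travel A) :=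
  strictAnti_of_hasDerivAt_neg (fun v => (hasStrictDerivAt_travel A v).hasDerivAt)
    (travel_deriv_neg hA)

theorem travel_pos {A v : ℝ} (hA : 0 < A) (hv : v < 1) : 0 < travel A v := by
  rw [← travel_one A]
  exact strictAnti_travel hA hv

/-- The integrand is even in `w`. Geometrically, reflection in the horizon is `v ↦ -v`, that is, `s
↦ 2 * travel A 0 - s`. -/
theorem travel_neg (A v : ℝ) : travel A (-v) = 2 * travel A 0 - travel A v := by
  have hi : ∀ a b, IntervalIntegrable (fun w => 2 * A / √(radialPoly A w)) MeasureTheory.volume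
    a b := fun a b => (continuous_radialIntegrand_right A).intervalIntegrable a b
  have h1 : travel A v = (∫ w in v..0, 2 * A / √(radialPoly A w)) + travel A 0 :=
    (intervalIntegral.integral_add_adjacent_intervals (hi _ _) (hi _ _)).symm
  have h2 : travel A (-v) = (∫ w in -v..0, 2 * A / √(radialPoly A w)) + travel A 0 :=
    (intervalIntegral.integral_add_adjacent_intervals (hi _ _) (hi _ _)).symm
  have h3 : (∫ w in -v..0, 2 * A / √(radialPoly A w))
      = ∫ w in 0..v, 2 * A / √(radialPoly A w) := by
    have := intervalIntegral.integral_comp_neg (a := 0) (b := v)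
      (fun w => 2 * A / √(radialPoly A w))
    simp only [neg_zero] at this
    rw [← this]
    simp [radialPoly, Even.neg_pow (by decide : Even 4)]
  rw [h1, h2, h3, intervalIntegral.integral_symm]
  ring

/-- The inverse of `travel A`. -/
noncomputable def travelInv (A s : ℝ) : ℝ := Function.invFun (travel A) s

theorem travelInv_travel {A : ℝ} (hA : 0 < A) (v : ℝ) : travelInv A (travel A v) = v :=
  Function.leftInverse_invFun (strictAnti_travel hA).injective v

theorem hasDerivAt_travelInv {A : ℝ} (hA : 0 < A) (v : ℝ) :
    HasDerivAt (travelInv A) (-(√(radialPoly A v) / (2 * A))) (travel A v) := by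
  have := ((hasStrictDerivAt_travel A v).to_local_left_inverse (travel_deriv_neg hA v).ne
    (Eventually.of_forall (travelInv_travel hA))).hasDerivAt
  simpa [inv_neg, inv_div] using this

/-- `travel A` is bounded, so `travelInv A` carries no information outside its range. Identities
proved at points `travel A v` hold in a neighbourhood because the range is open. -/
theorem eventually_mem_range_travel {A : ℝ} (hA : 0 < A) (v : ℝ) :
    ∀ᶠ s in 𝓝 (travel A v), ∃ u, travel A u = s := by
  rw [← (hasStrictDerivAt_travel A v).map_nhds_eq (travel_deriv_neg hA v).ne]
  exact eventually_map.2 (Eventually.of_forall fun u => ⟨u, rfl⟩)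

/-- The reciprocal of the area radius as a function of `-log |x|`. -/
noncomputable def profile (A s : ℝ) : ℝ := A * (1 - travelInv A s ^ 2)

/-- The derivative of `profile A`. -/
noncomputable def profileDeriv (A s : ℝ) : ℝ :=
  travelInv A s * √(radialPoly A (travelInv A s))

theorem profile_travel {A : ℝ} (hA : 0 < A) (v : ℝ) : profile A (travel A v) = A * (1 - v ^ 2) := by
  rw [profile, travelInv_travel hA]

theorem hasDerivAt_profile {A : ℝ} (hA : 0 < A) (v : ℝ) :
    HasDerivAt (profile A) (profileDeriv A (travel A v)) (travel A v) := by
  have h := (((hasDerivAt_travelInv hA v).fun_pow 2).const_sub 1).const_mul A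
  refine h.congr_deriv ?_
  rw [profileDeriv, travelInv_travel hA]
  field_simp
  push_cast
  ring

/-- Differentiating `Y'² = 1 + Y² - M Y³` and cancelling `Y'` would fail at the horizon, where `Y' =
0`. The chain rule through `v` covers that point too. -/
theorem hasDerivAt_profileDeriv {A : ℝ} (hA : 0 < A) (v : ℝ) :
    HasDerivAt (profileDeriv A) (profile A (travel A v)
      - 3 / 2 * ((1 + A ^ 2) / A ^ 3) * profile A (travel A v) ^ 2) (travel A v) := by
  have h1 : HasDerivAt (fun w => w * √(radialPoly A w))
      (√(radialPoly A v) + v * ((-(6 * v) + 4 * v ^ 3 - A ^ 2 * (4 * v * (1 - v ^ 2)))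
        / (2 * √(radialPoly A v)))) v := by
    have hQ : HasDerivAt (radialPoly A)
        (-(6 * v) + 4 * v ^ 3 - A ^ 2 * (4 * v * (1 - v ^ 2))) v := by
      have := ((((hasDerivAt_pow 2 v).const_mul 3).const_sub 3).fun_add (hasDerivAt_pow 4 v)).fun_add
        ((((hasDerivAt_pow 2 v).const_sub 1).fun_pow 2).const_mul (A ^ 2))
      refine this.congr_deriv ?_
      push_cast
      ring
    have := (hasDerivAt_id v).fun_mul (hQ.sqrt (radialPoly_pos A v).ne')
    refine this.congr_deriv ?_
    simp
  rw [← travelInv_travel hA v] at h1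
  have h2 := h1.comp (travel A v) (hasDerivAt_travelInv hA v)
  refine h2.congr_deriv ?_
  rw [profile_travel hA, travelInv_travel hA]
  have hs := sqrt_radialPoly_pos A v
  have hsq := Real.sq_sqrt (radialPoly_pos A v).le
  field_simp
  rw [hsq]
  unfold radialPoly
  ring

theorem profileDeriv_sq {A : ℝ} (hA : 0 < A) (v : ℝ) :
    profileDeriv A (travel A v) ^ 2 = 1 + profile A (travel A v) ^ 2
      - (1 + A ^ 2) / A ^ 3 * profile A (travel A v) ^ 3 := by
  rw [profileDeriv, profile_travel hA, travelInv_travel hA, mul_pow,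
    Real.sq_sqrt (radialPoly_pos A v).le, sq_mul_radialPoly hA.ne']

/-! ### Shooting -/

/-- With `z = A (1 - w²)`, the bound `M z ≤ 1 - ε²` gives `1 + z² - M z³ ≥ ε² (1 + z²)`. The travel
is therefore at most `ε⁻¹` times its hyperbolic value, the integral of `dz / √(1 + z²)`. -/
theorem travel_le_arsinh_div {A y ε v : ℝ} (hA : 0 < A) (hv : 0 < v) (hv1 : v ≤ 1)
    (hy : A * (1 - v ^ 2) = y) (hε : (1 + A ^ 2) / A ^ 3 * y ≤ 1 - ε ^ 2) (hε0 : 0 < ε) :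
    travel A v ≤ Real.arsinh y / ε := by
  have hcont : Continuous fun w : ℝ => ε⁻¹ * ((√(1 + (A * (1 - w ^ 2)) ^ 2))⁻¹ * (2 * A * w)) := by
    refine continuous_const.mul ((Continuous.inv₀ (by fun_prop) fun w => ?_).mul (by fun_prop))
    positivity
  have hint : ∫ w in v..1, ε⁻¹ * ((√(1 + (A * (1 - w ^ 2)) ^ 2))⁻¹ * (2 * A * w))
      = Real.arsinh y / ε := by
    have hd : ∀ w ∈ Set.uIcc v 1, HasDerivAt (fun w => -(ε⁻¹ * Real.arsinh (A * (1 - w ^ 2))))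
        (ε⁻¹ * ((√(1 + (A * (1 - w ^ 2)) ^ 2))⁻¹ * (2 * A * w))) w := by
      intro w _
      have h1 : HasDerivAt (fun w : ℝ => A * (1 - w ^ 2)) (-(2 * A * w)) w := by
        refine (((hasDerivAt_pow 2 w).const_sub 1).const_mul A).congr_deriv ?_
        push_cast
        ring
      refine (((Real.hasDerivAt_arsinh _).comp w h1).const_mul ε⁻¹).fun_neg.congr_deriv ?_
      ring
    rw [intervalIntegral.integral_eq_sub_of_hasDerivAt hd (hcont.intervalIntegrable _ _), hy]
    simp
    ring
  rw [← hint]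
  refine intervalIntegral.integral_mono_on hv1
    ((continuous_radialIntegrand_right A).intervalIntegrable _ _) (hcont.intervalIntegrable _ _) ?_
  intro w hw
  have hw0 : 0 < w := hv.trans_le hw.1
  set z := A * (1 - w ^ 2) with hz
  have hz0 : 0 ≤ z := mul_nonneg hA.le (by nlinarith [hw.2])
  have hzy : z ≤ y := by
    rw [← hy]
    apply mul_le_mul_of_nonneg_left _ hA.le
    nlinarith [hw.1]
  have hkey : ε * √(1 + z ^ 2) ≤ w * √(radialPoly A w) := by
    have e1 : ε * √(1 + z ^ 2) = √(ε ^ 2 * (1 + z ^ 2)) := by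
      rw [Real.sqrt_mul (sq_nonneg _), Real.sqrt_sq hε0.le]
    have e2 : w * √(radialPoly A w) = √(w ^ 2 * radialPoly A w) := by
      rw [Real.sqrt_mul (sq_nonneg _), Real.sqrt_sq hw0.le]
    rw [e1, e2]
    apply Real.sqrt_le_sqrt
    rw [sq_mul_radialPoly hA.ne', ← hz]
    set M := (1 + A ^ 2) / A ^ 3 with hM
    have hM0 : 0 < M := by positivity
    have h1 : M * z ≤ 1 - ε ^ 2 := (mul_le_mul_of_nonneg_left hzy hM0.le).trans hε
    nlinarith [mul_le_mul_of_nonneg_right h1 (sq_nonneg z), mul_nonneg hM0.le hz0]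
  have h3 : 0 < √(1 + z ^ 2) := by positivity
  have h4 := sqrt_radialPoly_pos A w
  rw [show ε⁻¹ * ((√(1 + z ^ 2))⁻¹ * (2 * A * w)) = 2 * A * w / (ε * √(1 + z ^ 2)) by
    field_simp, div_le_div_iff₀ h4 (by positivity)]
  nlinarith [mul_le_mul_of_nonneg_left hkey (by positivity : 0 ≤ 2 * A)]

/-- On `[0, 1]` one has `radialPoly A w ≤ 4 (1 + A² (1 - w)²)`, and the resulting lower bound for
the integrand integrates to `arsinh A`. -/
theorem arsinh_le_travel_zero {A : ℝ} (hA : 0 < A) : Real.arsinh A ≤ travel A 0 := by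
  have hcont : Continuous fun w : ℝ => (√(1 + (A * (1 - w)) ^ 2))⁻¹ * A := by
    refine (Continuous.inv₀ (by fun_prop) fun w => ?_).mul (by fun_prop)
    positivity
  have hint : ∫ w in (0 : ℝ)..1, (√(1 + (A * (1 - w)) ^ 2))⁻¹ * A = Real.arsinh A := by
    have hd : ∀ w ∈ Set.uIcc (0 : ℝ) 1, HasDerivAt (fun w => -Real.arsinh (A * (1 - w)))
        ((√(1 + (A * (1 - w)) ^ 2))⁻¹ * A) w := by
      intro w _
      have h1 : HasDerivAt (fun w : ℝ => A * (1 - w)) (-A) w := by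
        refine (((hasDerivAt_id w).const_sub 1).const_mul A).congr_deriv ?_
        ring
      refine ((Real.hasDerivAt_arsinh _).comp w h1).fun_neg.congr_deriv ?_
      ring
    rw [intervalIntegral.integral_eq_sub_of_hasDerivAt hd (hcont.intervalIntegrable _ _)]
    simp
  rw [← hint]
  refine intervalIntegral.integral_mono_on zero_le_one (hcont.intervalIntegrable _ _)
    ((continuous_radialIntegrand_right A).intervalIntegrable _ _) ?_
  intro w hw
  have hle : √(radialPoly A w) ≤ 2 * √(1 + (A * (1 - w)) ^ 2) := by
    rw [show 2 * √(1 + (A * (1 - w)) ^ 2) = √(2 ^ 2 * (1 + (A * (1 - w)) ^ 2)) by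
      rw [Real.sqrt_mul (sq_nonneg _), Real.sqrt_sq (by norm_num)]]
    apply Real.sqrt_le_sqrt
    unfold radialPoly
    have h1 : w ^ 2 ≤ 1 := by nlinarith [hw.1, hw.2]
    have h2 : (1 + w) ^ 2 ≤ 4 := by nlinarith [hw.1, hw.2]
    have h3 := mul_le_mul_of_nonneg_left h2 (sq_nonneg (A * (1 - w)))
    nlinarith [mul_nonneg (sq_nonneg w) (sub_nonneg.2 h1)]
  have h3 : 0 < √(1 + (A * (1 - w)) ^ 2) := by positivity
  have h4 := sqrt_radialPoly_pos A w
  rw [show (√(1 + (A * (1 - w)) ^ 2))⁻¹ * A = A / √(1 + (A * (1 - w)) ^ 2) by ring,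
    div_le_div_iff₀ h3 h4]
  nlinarith [mul_le_mul_of_nonneg_left hle hA.le]

/-- Every value below the hyperbolic one is attained at distance `s` by some positive mass. -/
theorem exists_travel_eq {s y : ℝ} (hs : 0 < s) (hy : 0 < y) (hys : y < Real.sinh s) :
    ∃ A v, 0 < A ∧ v ∈ Set.Ioo (-1 : ℝ) 1 ∧ travel A v = s ∧ A * (1 - v ^ 2) = y := by
  have hlt : Real.arsinh y < s := by
    rw [← Real.arsinh_sinh s]
    exact Real.arsinh_lt_arsinh.2 hys
  -- Fixing the reciprocal area radius at `y` forces `A = y / (1 - v²)`. The remaining parameter `v`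
  -- runs through the horizon position `0`, so one intermediate value argument covers both sides.
  set F : ℝ → ℝ := fun v => travel (y / (1 - v ^ 2)) v with hF
  have hpos : ∀ v ∈ Set.Ioo (-1 : ℝ) 1, 0 < 1 - v ^ 2 := fun v hv => by nlinarith [hv.1, hv.2]
  have hcont : ContinuousOn F (Set.Ioo (-1) 1) := by
    refine continuous_travel.comp_continuousOn (f := fun v : ℝ => (y / (1 - v ^ 2), v)) ?_
    exact (continuousOn_const.div (by fun_prop) fun v hv => (hpos v hv).ne').prodMk continuousOn_id
  have hsmall : ∃ v ∈ Set.Ioo (-1 : ℝ) 1, F v < s := by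
    obtain ⟨ε, hε0, hε1, hε⟩ : ∃ ε : ℝ, 0 < ε ∧ ε < 1 ∧ Real.arsinh y / ε < s := by
      have h0 := Real.arsinh_pos_iff.2 hy
      have : Real.arsinh y / s < 1 := (div_lt_one hs).2 hlt
      obtain ⟨ε, h1, h2⟩ := exists_between this
      have h3 : 0 < ε := lt_trans (by positivity) h1
      exact ⟨ε, h3, h2, by rwa [div_lt_comm₀ h3 hs]⟩
    -- Large `A` means small mass. `A > 1` gives `M ≤ 2 / A`, and the last summand then makes `M y ≤
    -- 1 - ε²`.
    set A : ℝ := y + 1 + 2 * y / (1 - ε ^ 2) with hA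
    have hε2 : 0 < 1 - ε ^ 2 := by nlinarith
    have hq : 0 < 2 * y / (1 - ε ^ 2) := by positivity
    have hA1 : 1 < A := by linarith
    have hAy : y < A := by linarith
    have hyA : y / A < 1 := (div_lt_one (by linarith)).2 hAy
    have hyA0 : 0 < y / A := by positivity
    set v := √(1 - y / A) with hv
    have hv2 : v ^ 2 = 1 - y / A := Real.sq_sqrt (by linarith)
    have hv0 : 0 < v := Real.sqrt_pos.2 (by linarith)
    have hv1 : v < 1 := by nlinarith
    have hAv : A * (1 - v ^ 2) = y := by
      rw [hv2]
      field_simp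
      ring
    refine ⟨v, ⟨by linarith, hv1⟩, ?_⟩
    have hFA : y / (1 - v ^ 2) = A := by
      rw [← hAv]
      exact mul_div_cancel_right₀ _ (by rw [hv2]; linarith)
    simp only [hF, hFA]
    refine (travel_le_arsinh_div (by linarith) hv0 hv1.le hAv ?_ hε0).trans_lt hε
    have h1 : (1 + A ^ 2) / A ^ 3 ≤ 2 / A := by
      rw [div_le_div_iff₀ (by positivity) (by positivity)]
      nlinarith [mul_pos (by linarith : 0 < A) (by nlinarith : 0 < A ^ 2 - 1)]
    have h2 : 2 / A * y ≤ 1 - ε ^ 2 := by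
      have : 2 * y / (1 - ε ^ 2) < A := by linarith
      rw [div_lt_iff₀ hε2] at this
      rw [div_mul_eq_mul_div, div_le_iff₀ (by linarith)]
      linarith
    exact (mul_le_mul_of_nonneg_right h1 hy.le).trans h2
  have hlarge : ∃ v ∈ Set.Ioo (-1 : ℝ) 1, s < F v := by
    set A : ℝ := y + 1 + Real.sinh s with hA
    have hs0 := Real.sinh_pos_iff.2 hs
    have hyA : y / A < 1 := (div_lt_one (by linarith)).2 (by linarith)
    have hyA0 : 0 < y / A := by positivity
    set v := √(1 - y / A) with hv
    have hv2 : v ^ 2 = 1 - y / A := Real.sq_sqrt (by linarith)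
    have hv0 : 0 < v := Real.sqrt_pos.2 (by linarith)
    have hv1 : v < 1 := by nlinarith
    -- The point beyond the horizon is taken, so its travel exceeds `travel A 0`, which is at least
    -- `arsinh A > s`.
    refine ⟨-v, ⟨by linarith, by linarith⟩, ?_⟩
    have hFA : y / (1 - (-v) ^ 2) = A := by
      rw [neg_sq, hv2, sub_sub_cancel, div_div_cancel₀ hy.ne']
    simp only [hF, hFA]
    have hA0 : 0 < A := by linarith
    calc s = Real.arsinh (Real.sinh s) := (Real.arsinh_sinh s).symm
      _ < Real.arsinh A := Real.arsinh_lt_arsinh.2 (by linarith)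
      _ ≤ travel A 0 := arsinh_le_travel_zero hA0
      _ < travel A (-v) := strictAnti_travel hA0 (by linarith)
  obtain ⟨v₁, hv₁, h₁⟩ := hsmall
  obtain ⟨v₂, hv₂, h₂⟩ := hlarge
  obtain ⟨v, hv, hvs⟩ := isPreconnected_Ioo.intermediate_value hv₁ hv₂ hcont ⟨h₁.le, h₂.le⟩
  refine ⟨y / (1 - v ^ 2), v, div_pos hy (hpos v hv), hv, hvs, ?_⟩
  exact div_mul_cancel₀ _ (hpos v hv).ne'

/-! ### The anti-de Sitter-Schwarzschild metric in terms of the profile -/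

/-- The mass for which the reciprocal of the horizon radius is `A`. -/
noncomputable def massOf (A : ℝ) : ℝ := (1 + A ^ 2) / A ^ 3

theorem massOf_pos {A : ℝ} (hA : 0 < A) : 0 < massOf A := by
  unfold massOf
  positivity

theorem horizonRadius_massOf {A : ℝ} (hA : 0 < A) : horizonRadius (massOf A) = A⁻¹ := by
  have : {r : ℝ | 0 < r ∧ 1 + r ^ 2 - massOf A / r = 0} = {A⁻¹} := by
    ext r
    simp only [Set.mem_ofPred_eq, Set.mem_singleton_iff, massOf]
    constructor
    · rintro ⟨h1, h2⟩
      field_simp at h2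
      -- The horizon equation factors, and its quadratic factor is positive for `r, A > 0`.
      have h3 : (r * A - 1) * ((r * A) ^ 2 + r * A + 1 + A ^ 2) = 0 := by
        linear_combination h2
      have h4 : 0 < r * A := by positivity
      rcases mul_eq_zero.1 h3 with h | h
      · exact eq_inv_of_mul_eq_one_left (by linarith)
      · nlinarith
    · rintro rfl
      refine ⟨by positivity, ?_⟩
      field_simp
      ring
  rw [horizonRadius, this, csInf_singleton]

/-- The substitution is `1 / t = A (1 - w²)`. At the horizon the integrand is singular but the
antiderivative stays continuous, so `r = A⁻¹` is included. -/
theorem hFun_massOf {A r : ℝ} (hA : 0 < A) (hr : A⁻¹ ≤ r) :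
    hFun (massOf A) r = travel A √(1 - (A * r)⁻¹) := by
  have hr0 : 0 < r := (inv_pos.2 hA).trans_le hr
  have hlim : Tendsto (fun t => -travel A √(1 - (A * t)⁻¹)) atTop (𝓝 0) := by
    have h1 : Tendsto (fun t : ℝ => √(1 - (A * t)⁻¹)) atTop (𝓝 1) := by
      have h2 : Tendsto (fun t : ℝ => (A * t)⁻¹) atTop (𝓝 0) :=
        tendsto_inv_atTop_zero.comp (tendsto_id.const_mul_atTop hA)
      have := (h2.const_sub 1).sqrt
      simpa using this
    have h3 := (((continuous_travel_right A).tendsto 1).comp h1).neg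
    simpa [travel_one, Function.comp_def] using h3
  have hcont : ContinuousWithinAt (fun t => -travel A √(1 - (A * t)⁻¹)) (Set.Ici r) r := by
    apply ContinuousAt.continuousWithinAt
    refine ((continuous_travel_right A).continuousAt.comp
      (f := fun t : ℝ => √(1 - (A * t)⁻¹)) ?_).neg
    apply ContinuousAt.sqrt
    exact continuousAt_const.sub (ContinuousAt.inv₀ (by fun_prop) (by positivity))
  have hderiv : ∀ t ∈ Set.Ioi r, HasDerivAt (fun t => -travel A √(1 - (A * t)⁻¹))
      (1 / √(t * (t + t ^ 3 - massOf A))) t := by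
    intro t ht
    have ht0 : 0 < t := hr0.trans ht
    have hAt : 1 < A * t := by
      have := mul_lt_mul_of_pos_left (hr.trans_lt ht) hA
      rwa [mul_inv_cancel₀ hA.ne'] at this
    have hin : 0 < 1 - (A * t)⁻¹ := sub_pos.2 (inv_lt_one_of_one_lt₀ hAt)
    set w := √(1 - (A * t)⁻¹) with hw
    have hw0 : 0 < w := Real.sqrt_pos.2 hin
    have hw2 : w ^ 2 = 1 - (A * t)⁻¹ := Real.sq_sqrt hin.le
    have h1 : HasDerivAt (fun t : ℝ => √(1 - (A * t)⁻¹)) ((A / (A * t) ^ 2) / (2 * w)) t := by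
      have h2 : HasDerivAt (fun t : ℝ => 1 - (A * t)⁻¹) (A / (A * t) ^ 2) t := by
        refine ((((hasDerivAt_id t).const_mul A).fun_inv (by positivity)).const_sub 1).congr_deriv ?_
        simp
        ring
      exact h2.sqrt hin.ne'
    have h3 := ((hasStrictDerivAt_travel A w).hasDerivAt.comp t h1).fun_neg
    refine h3.congr_deriv ?_
    have hQ := sqrt_radialPoly_pos A w
    have h4 : √(t * (t + t ^ 3 - massOf A)) = t ^ 2 * (w * √(radialPoly A w)) := by
      have h5 : t * (t + t ^ 3 - massOf A) = (t ^ 2) ^ 2 * (w ^ 2 * radialPoly A w) := by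
        rw [sq_mul_radialPoly hA.ne', hw2, massOf]
        field_simp
        ring
      rw [h5, Real.sqrt_mul (by positivity), Real.sqrt_sq (by positivity),
        Real.sqrt_mul (by positivity), Real.sqrt_sq hw0.le]
    rw [h4]
    field_simp
  have := MeasureTheory.integral_Ioi_of_hasDerivAt_of_nonneg hcont hderiv
    (fun t _ => by positivity) hlim
  rw [hFun, this]
  ring

/-- This identifies `h(r)` with `-log |x|`, the reason for using that coordinate. -/
theorem log_coth {h : ℝ} (hh : 0 < h) :
    Real.log (Real.cosh (h / 2) / Real.sinh (h / 2)) = radiusOf (Real.exp (-h)) := by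
  have h1 : Real.exp (-h) < 1 := Real.exp_lt_one_iff.2 (by linarith)
  have h2 : Real.exp (-h) = Real.exp (-(h / 2)) * Real.exp (-(h / 2)) := by
    rw [← Real.exp_add]
    ring_nf
  have h3 : Real.exp (h / 2) * Real.exp (-(h / 2)) = 1 := by
    rw [← Real.exp_add]
    simp
  have h4 := Real.exp_pos (h / 2)
  have h5 := Real.exp_pos (-(h / 2))
  have h6 : 0 < Real.sinh (h / 2) := Real.sinh_pos_iff.2 (by linarith)
  unfold radiusOf
  congr 1
  rw [div_eq_div_iff h6.ne' (by linarith), h2, Real.sinh_eq, Real.cosh_eq]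
  linear_combination (-Real.exp (-(h / 2))) * h3

theorem rhoFun_massOf {A r : ℝ} (hA : 0 < A) (hr : A⁻¹ ≤ r) :
    rhoFun (massOf A) r = radiusOf (Real.exp (-travel A √(1 - (A * r)⁻¹))) := by
  have hr0 : 0 < r := (inv_pos.2 hA).trans_le hr
  have : 0 < (A * r)⁻¹ := by positivity
  rw [rhoFun, hFun_massOf hA hr, log_coth]
  apply travel_pos hA
  rw [Real.sqrt_lt' one_pos]
  linarith

theorem exp_neg_mem_Ioo {s : ℝ} (hs : 0 < s) : Real.exp (-s) ∈ Set.Ioo (-1 : ℝ) 1 :=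
  ⟨by linarith [Real.exp_pos (-s)], Real.exp_lt_one_iff.2 (by linarith)⟩

theorem horizonRho_massOf {A : ℝ} (hA : 0 < A) :
    horizonRho (massOf A) = radiusOf (Real.exp (-travel A 0)) := by
  rw [horizonRho, horizonRadius_massOf hA, rhoFun_massOf hA le_rfl]
  simp [hA.ne']

theorem bFun_massOf {A : ℝ} (hA : 0 < A) : bFun (massOf A) = Real.exp (-travel A 0) := by
  have := euclRadius_radiusOf (exp_neg_mem_Ioo (travel_pos hA zero_lt_one))
  rwa [← horizonRho_massOf hA] at this

theorem rFun_massOf {A v : ℝ} (hA : 0 < A) (hv : 0 ≤ v) (hv1 : v < 1) :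
    rFun (massOf A) (radiusOf (Real.exp (-travel A v))) = (A * (1 - v ^ 2))⁻¹ := by
  have hv2 : 0 < 1 - v ^ 2 := by nlinarith
  have hmem : A⁻¹ ≤ (A * (1 - v ^ 2))⁻¹ := by
    apply inv_anti₀ (by positivity)
    nlinarith [sq_nonneg v]
  have hval : rhoFun (massOf A) (A * (1 - v ^ 2))⁻¹ = radiusOf (Real.exp (-travel A v)) := by
    rw [rhoFun_massOf hA hmem]
    congr 4
    rw [show 1 - (A * (A * (1 - v ^ 2))⁻¹)⁻¹ = v ^ 2 by field_simp; ring, Real.sqrt_sq hv]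
  -- `Function.invFunOn` picks an arbitrary preimage; injectivity pins it down.
  have hinj : Set.InjOn (rhoFun (massOf A)) (Set.Ici A⁻¹) := by
    intro r₁ h₁ r₂ h₂ h
    have hpos : ∀ r ∈ Set.Ici A⁻¹, 0 < (A * r)⁻¹ ∧ (A * r)⁻¹ ≤ 1 := by
      intro r hr
      have h1 : 1 ≤ A * r := by
        have := mul_le_mul_of_nonneg_left (Set.mem_Ici.1 hr) hA.le
        rwa [mul_inv_cancel₀ hA.ne'] at this
      exact ⟨inv_pos.2 (by linarith), inv_le_one_of_one_le₀ h1⟩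
    have htr : ∀ r ∈ Set.Ici A⁻¹, 0 < travel A √(1 - (A * r)⁻¹) := by
      intro r hr
      apply travel_pos hA
      rw [Real.sqrt_lt' one_pos]
      linarith [(hpos r hr).1]
    rw [rhoFun_massOf hA h₁, rhoFun_massOf hA h₂] at h
    have h3 := strictMonoOn_radiusOf.injOn (exp_neg_mem_Ioo (htr _ h₁))
      (exp_neg_mem_Ioo (htr _ h₂)) h
    have h4 := (strictAnti_travel hA).injective (neg_injective (Real.exp_injective h3))
    rw [Real.sqrt_inj (by linarith [(hpos _ h₁).2]) (by linarith [(hpos _ h₂).2])] at h4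
    have h5 := inv_injective (sub_right_injective h4)
    exact mul_left_cancel₀ hA.ne' h5
  unfold rFun
  rw [horizonRadius_massOf hA]
  have hex : ∃ r ∈ Set.Ici A⁻¹,
      rhoFun (massOf A) r = radiusOf (Real.exp (-travel A v)) := ⟨_, hmem, hval⟩
  exact hinj (Function.invFunOn_mem hex) hmem ((Function.invFunOn_eq hex).trans hval.symm)

theorem sinh_radiusOf_exp_neg {s : ℝ} (hs : 0 < s) :
    Real.sinh (radiusOf (Real.exp (-s))) = (Real.sinh s)⁻¹ := by
  have h1 : Real.exp (-s) < 1 := Real.exp_lt_one_iff.2 (by linarith)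
  have h2 := Real.exp_pos (-s)
  have h3 : Real.exp s * Real.exp (-s) = 1 := by
    rw [← Real.exp_add]
    simp
  have h4 : 0 < Real.sinh s := Real.sinh_pos_iff.2 hs
  have hpos : 0 < 1 - Real.exp (-s) := by linarith
  apply eq_inv_of_mul_eq_one_left
  rw [radiusOf, Real.sinh_log (by positivity), Real.sinh_eq]
  field_simp
  linear_combination 4 * h3

theorem psiFun_massOf {A v : ℝ} (hA : 0 < A) (hv : 0 ≤ v) (hv1 : v < 1) :
    psiFun (massOf A) (Real.exp (-travel A v))
      = √(Real.sinh (travel A v) / (A * (1 - v ^ 2))) := by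
  rw [psiFun, phiOuter, rFun_massOf hA hv hv1, sinh_radiusOf_exp_neg (travel_pos hA hv1)]
  congr 1
  rw [div_inv_eq_mul]
  ring

/-- For `v < 0` the inner branch evaluates `psiFun` at the mirror point `-v`, and its square-root
factor converts `sinh (2 H - s)` into `sinh s`, where `H = travel A 0`. -/
theorem fFun_massOf {A v : ℝ} (hA : 0 < A) (hv : v ∈ Set.Ioo (-1 : ℝ) 1) :
    fFun (massOf A) (Real.exp (-travel A v))
      = √(Real.sinh (travel A v) / (A * (1 - v ^ 2))) := by
  rw [fFun, bFun_massOf hA]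
  rcases le_or_gt 0 v with hv0 | hv0
  · rw [if_pos, psiFun_massOf hA hv0 hv.2]
    exact Real.exp_le_exp.2 (neg_le_neg ((strictAnti_travel hA).antitone hv0))
  · have hlt := strictAnti_travel hA hv0
    rw [if_neg (not_le.2 (Real.exp_lt_exp.2 (neg_lt_neg hlt)))]
    have hrefl := travel_neg A v
    set s := travel A v with hs
    set H := travel A 0 with hH
    have hs0 : 0 < s := travel_pos hA hv.2
    have hs' : 0 < 2 * H - s := hrefl ▸ travel_pos hA (by linarith [hv.1])
    have e1 : Real.exp (-H) ^ 2 / Real.exp (-s) = Real.exp (-travel A (-v)) := by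
      rw [hrefl, ← Real.exp_nat_mul, ← Real.exp_sub]
      congr 1
      push_cast
      ring
    rw [e1, psiFun_massOf hA (by linarith) (by linarith [hv.1]), hrefl, neg_sq]
    have hsh := Real.sinh_pos_iff.2 hs0
    have hsh' := Real.sinh_pos_iff.2 hs'
    have hv2 : 0 < 1 - v ^ 2 := by nlinarith [hv.1, hv.2]
    have e2 : (1 - Real.exp (-s) ^ 2) / (Real.exp (-s) ^ 2 - Real.exp (-H) ^ 4)
        = Real.exp H ^ 2 * (Real.sinh s / Real.sinh (2 * H - s)) := by
      have a1 : 1 - Real.exp (-s) ^ 2 = 2 * Real.exp (-s) * Real.sinh s := by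
        rw [Real.sinh_eq]
        have : Real.exp s * Real.exp (-s) = 1 := by
          rw [← Real.exp_add]
          simp
        linear_combination -this
      have a2 : Real.exp (-s) ^ 2 - Real.exp (-H) ^ 4
          = 2 * Real.exp (-s) * (Real.exp (-H) ^ 2 * Real.sinh (2 * H - s)) := by
        have b1 : Real.exp (2 * H - s) * Real.exp (-H) ^ 2 = Real.exp (-s) := by
          rw [← Real.exp_nat_mul, ← Real.exp_add]
          congr 1
          push_cast
          ring
        have b2 : Real.exp (-(2 * H - s)) * Real.exp (-s) = Real.exp (-H) ^ 2 := by
          rw [← Real.exp_nat_mul, ← Real.exp_add]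
          congr 1
          push_cast
          ring
        rw [Real.sinh_eq]
        linear_combination (-Real.exp (-s)) * b1 + Real.exp (-H) ^ 2 * b2
      rw [a1, a2, Real.exp_neg H]
      have := Real.exp_pos (-s)
      have := Real.exp_pos H
      field_simp
    rw [e2, Real.sqrt_mul (by positivity), Real.sqrt_sq (Real.exp_pos _).le]
    rw [show Real.exp (-H) * √(Real.sinh (2 * H - s) / (A * (1 - v ^ 2)))
        * (Real.exp H * √(Real.sinh s / Real.sinh (2 * H - s)))
      = (Real.exp (-H) * Real.exp H) * (√(Real.sinh (2 * H - s) / (A * (1 - v ^ 2)))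
        * √(Real.sinh s / Real.sinh (2 * H - s))) by ring, ← Real.exp_add, neg_add_cancel,
      Real.exp_zero, one_mul, ← Real.sqrt_mul (by positivity)]
    congr 1
    field_simp

theorem innerRho_massOf_lt {A v ρ : ℝ} (hA : 0 < A) (hv : -1 < v)
    (hρ : euclRadius ρ = Real.exp (-travel A v)) : innerRho (massOf A) < ρ := by
  have hH := travel_pos hA zero_lt_one
  have e : bFun (massOf A) ^ 2 = Real.exp (-(2 * travel A 0)) := by
    rw [bFun_massOf hA, ← Real.exp_nat_mul]
    congr 1
    push_cast
    ring
  rw [innerRho, e, ← radiusOf_euclRadius ρ]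
  refine strictMonoOn_radiusOf (exp_neg_mem_Ioo (by linarith)) (euclRadius_mem ρ) ?_
  rw [hρ, Real.exp_lt_exp]
  -- By the reflection formula, positivity of `travel A (-v)` is exactly `travel A v < 2 * travel A
  -- 0`.
  have := travel_pos hA (by linarith : -v < 1)
  rw [travel_neg] at this
  linarith

/-! ### Radial solutions of the Liouville equation -/

theorem twiceDiffAt_radial {n : ℕ} {K K₁ : ℝ → ℝ} {K₂ : ℝ} {x : Space n}
    (h₁ : ∀ᶠ q in 𝓝 (‖x‖ ^ 2), HasDerivAt K (K₁ q) q) (h₂ : HasDerivAt K₁ K₂ (‖x‖ ^ 2)) :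
    TwiceDiffAt (fun y => K (‖y‖ ^ 2)) x ∧
      (∀ i, partialDeriv i (fun y => K (‖y‖ ^ 2)) x = 2 * x i * K₁ (‖x‖ ^ 2)) ∧
      ∀ i, partialDeriv i (partialDeriv i fun y => K (‖y‖ ^ 2)) x
        = 2 * K₁ (‖x‖ ^ 2) + 4 * x i ^ 2 * K₂ := by
  have hN : ∀ y : Space n, HasFDerivAt (fun y : Space n => ‖y‖ ^ 2) (2 • innerSL ℝ y) y :=
    fun y => (hasStrictFDerivAt_norm_sq y).hasFDerivAt
  have hNc : Tendsto (fun y : Space n => ‖y‖ ^ 2) (𝓝 x) (𝓝 (‖x‖ ^ 2)) :=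
    (hN x).continuousAt
  have hinner : ∀ (y : Space n) i, (2 • innerSL ℝ y) (EuclideanSpace.single i 1) = 2 * y i := by
    intro y i
    simp [EuclideanSpace.inner_single_right]
  have hd : ∀ᶠ y in 𝓝 x, HasFDerivAt (fun y : Space n => K (‖y‖ ^ 2))
      (K₁ (‖y‖ ^ 2) • 2 • innerSL ℝ y) y :=
    (hNc.eventually h₁).mono fun y hy => hy.comp_hasFDerivAt y (hN y)
  have hpd : ∀ i, partialDeriv i (fun y => K (‖y‖ ^ 2)) =ᶠ[𝓝 x]
      fun y => 2 * y i * K₁ (‖y‖ ^ 2) := by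
    intro i
    filter_upwards [hd] with y hy
    unfold partialDeriv
    rw [hy.fderiv, smul_apply, hinner, smul_eq_mul]
    ring
  have hcoord : ∀ i, HasFDerivAt (fun y : Space n => 2 * y i)
      ((2 : ℝ) • (EuclideanSpace.proj i : Space n →L[ℝ] ℝ)) x := fun i =>
    (EuclideanSpace.proj i : Space n →L[ℝ] ℝ).hasFDerivAt.const_mul 2
  have hpd2 : ∀ i, HasFDerivAt (fun y : Space n => 2 * y i * K₁ (‖y‖ ^ 2)) _ x := fun i =>
    (hcoord i).mul (h₂.comp_hasFDerivAt x (hN x))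
  refine ⟨⟨hd.mono fun y hy => hy.differentiableAt, fun i => ?_⟩, fun i => (hpd i).eq_of_nhds,
    fun i => ?_⟩
  · exact (hpd i).differentiableAt_iff.2 (hpd2 i).differentiableAt
  · rw [partialDeriv_congr i (hpd i)]
    conv_lhs => unfold partialDeriv
    rw [(hpd2 i).fderiv]
    change 2 * x i * (K₂ * (2 • innerSL ℝ x) (EuclideanSpace.single i 1))
      + K₁ (‖x‖ ^ 2) * (2 * (EuclideanSpace.single i 1 : Space n) i) = _
    rw [hinner]
    simp
    ring

theorem profile_pos {A v : ℝ} (hA : 0 < A) (hv : v ∈ Set.Ioo (-1 : ℝ) 1) :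
    0 < profile A (travel A v) := by
  rw [profile_travel hA]
  exact mul_pos hA (by nlinarith [hv.1, hv.2])

theorem solvesLiouville_profile {A v : ℝ} {x : Space 3} (hA : 0 < A)
    (hv : v ∈ Set.Ioo (-1 : ℝ) 1) (hx : -Real.log ‖x‖ = travel A v) (hx0 : x ≠ 0) :
    TwiceDiffAt (fun y => -Real.log ‖y‖ - Real.log (profile A (-Real.log ‖y‖))) x ∧
      SolvesLiouville (fun y => -Real.log ‖y‖ - Real.log (profile A (-Real.log ‖y‖))) x := by
  have hxn : 0 < ‖x‖ := norm_pos_iff.2 hx0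
  have hq : 0 < ‖x‖ ^ 2 := by positivity
  have hlog : ∀ y : Space 3, -Real.log ‖y‖ = -(1 / 2 * Real.log (‖y‖ ^ 2)) := by
    intro y
    rw [Real.log_pow]
    push_cast
    ring
  set σ : ℝ → ℝ := fun q => -(1 / 2 * Real.log q) with hσ
  set s := travel A v with hs
  have hσx : σ (‖x‖ ^ 2) = s := by rw [← hx, hlog]
  set Y := profile A with hY
  set Y₁ := profileDeriv A with hY₁
  set Y₂ := Y s - 3 / 2 * ((1 + A ^ 2) / A ^ 3) * Y s ^ 2 with hY₂
  have hYpos : 0 < Y s := profile_pos hA hv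
  have hev : ∀ᶠ t in 𝓝 s, HasDerivAt Y (Y₁ t) t ∧ 0 < Y t := by
    refine Eventually.and ?_ ?_
    · filter_upwards [eventually_mem_range_travel hA v]
      rintro _ ⟨u, rfl⟩
      exact hasDerivAt_profile hA u
    · exact (hasDerivAt_profile hA v).continuousAt.eventually (lt_mem_nhds hYpos)
  have hσd : ∀ q, 0 < q → HasDerivAt σ (-(1 / 2 * q⁻¹)) q := fun q hq =>
    ((Real.hasDerivAt_log hq.ne').const_mul (1 / 2)).fun_neg
  have hK₁ : ∀ᶠ q in 𝓝 (‖x‖ ^ 2), HasDerivAt (fun q => σ q - Real.log (Y (σ q)))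
      (-(1 / 2 * q⁻¹) * (1 - Y₁ (σ q) / Y (σ q))) q := by
    have hc : Tendsto σ (𝓝 (‖x‖ ^ 2)) (𝓝 s) := hσx ▸ (hσd _ hq).continuousAt
    filter_upwards [hc.eventually hev, lt_mem_nhds hq] with q h1 h2
    have h3 := (h1.1.comp q (hσd q h2)).log h1.2.ne'
    refine ((hσd q h2).fun_sub h3).congr_deriv ?_
    simp only [Function.comp]
    ring
  have hYs : HasDerivAt Y (Y₁ s) s := hasDerivAt_profile hA v
  have hY₁s : HasDerivAt Y₁ Y₂ s := hasDerivAt_profileDeriv hA v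
  have hK₂ : HasDerivAt (fun q => -(1 / 2 * q⁻¹) * (1 - Y₁ (σ q) / Y (σ q)))
      (1 / 2 * (‖x‖ ^ 2)⁻¹ ^ 2 * (1 - Y₁ s / Y s)
        + 1 / 4 * (‖x‖ ^ 2)⁻¹ ^ 2 * (-((Y₂ * Y s - Y₁ s * Y₁ s) / Y s ^ 2))) (‖x‖ ^ 2) := by
    have h1 : HasDerivAt (fun t => 1 - Y₁ t / Y t) (-((Y₂ * Y s - Y₁ s * Y₁ s) / Y s ^ 2)) s :=
      (hY₁s.fun_div hYs hYpos.ne').const_sub 1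
    rw [← hσx] at h1
    have h2 := h1.comp _ (hσd _ hq)
    have h3 := (((hasDerivAt_inv hq.ne').const_mul (1 / 2)).fun_neg).fun_mul h2
    refine h3.congr_deriv ?_
    simp only [Function.comp, hσx]
    field_simp
    ring
  obtain ⟨r1, r2, r3⟩ := twiceDiffAt_radial hK₁ hK₂
  have hfun : (fun y : Space 3 => -Real.log ‖y‖ - Real.log (Y (-Real.log ‖y‖)))
      = fun y => σ (‖y‖ ^ 2) - Real.log (Y (σ (‖y‖ ^ 2))) := by
    funext y
    rw [hlog]
  rw [hfun]
  refine ⟨r1, ?_⟩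
  unfold SolvesLiouville
  simp only [r2, r3, hσx]
  have hexp : Real.exp (2 * (s - Real.log (Y s))) = (‖x‖ ^ 2)⁻¹ / Y s ^ 2 := by
    rw [mul_sub, Real.exp_sub, ← Real.log_rpow hYpos, Real.exp_log (by positivity), ← hx,
      show 2 * -Real.log ‖x‖ = -(((2 : ℕ) : ℝ) * Real.log ‖x‖) by push_cast; ring,
      Real.exp_neg, Real.exp_nat_mul, Real.exp_log hxn]
    norm_num
  rw [hexp]
  have hsq : Y₁ s ^ 2 = 1 + Y s ^ 2 - (1 + A ^ 2) / A ^ 3 * Y s ^ 3 := profileDeriv_sq hA v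
  have hnorm : x 0 ^ 2 + x 1 ^ 2 + x 2 ^ 2 = ‖x‖ ^ 2 := by
    rw [EuclideanSpace.real_norm_sq_eq, Fin.sum_univ_three]
  simp only [Fin.sum_univ_three]
  generalize ‖x‖ ^ 2 = q at *
  set m := (1 + A ^ 2) / A ^ 3
  have hyne := hYpos.ne'
  clear_value m
  generalize Y s = y at *
  generalize Y₁ s = z at *
  rw [hY₂]
  -- For a function `K` of `q = |x|²` in three dimensions, `Δ = 6 K' + 4 q K''` and `|∇|² = 4 q
  -- K'²`. What then remains is a multiple of the first-order equation `hsq`.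
  have hgen : ∀ k₁ k₂ : ℝ, 2 * (2 * k₁ + 4 * x 0 ^ 2 * k₂ + (2 * k₁ + 4 * x 1 ^ 2 * k₂)
      + (2 * k₁ + 4 * x 2 ^ 2 * k₂)) + ((2 * x 0 * k₁) ^ 2 + (2 * x 1 * k₁) ^ 2
      + (2 * x 2 * k₁) ^ 2) = 12 * k₁ + 8 * q * k₂ + 4 * q * k₁ ^ 2 := by
    intro k₁ k₂
    rw [← hnorm]
    ring
  rw [hgen]
  field_simp
  linear_combination 48 * hsq

theorem exists_travel_eq_of_mem_exterior {A v₀ ρ : ℝ} (hv₀ : v₀ < 1)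
    (hρ : euclRadius ρ = Real.exp (-travel A v₀)) {x : Space 3} (hx : x ∈ exterior ρ) :
    0 < ‖x‖ ∧ ∃ v ∈ Set.Ico v₀ 1, -Real.log ‖x‖ = travel A v := by
  obtain ⟨h1, h2⟩ := mem_exterior.1 hx
  rw [hρ] at h1
  have h0 : 0 < ‖x‖ := (Real.exp_pos _).trans_le h1
  refine ⟨h0, ?_⟩
  have h3 : -Real.log ‖x‖ ≤ travel A v₀ := by
    have := (Real.le_log_iff_exp_le h0).2 h1
    linarith
  have h4 : 0 < -Real.log ‖x‖ := neg_pos.2 (Real.log_neg h0 h2)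
  obtain ⟨v, hv, hvx⟩ := intermediate_value_Icc' hv₀.le (continuous_travel_right A).continuousOn
    (show -Real.log ‖x‖ ∈ Set.Icc (travel A 1) (travel A v₀) from ⟨travel_one A ▸ h4.le, h3⟩)
  refine ⟨v, ⟨hv.1, lt_of_le_of_ne hv.2 ?_⟩, hvx.symm⟩
  rintro rfl
  rw [travel_one] at hvx
  linarith

/-- The conformal factor of the anti-de Sitter-Schwarzschild metric in terms of the profile. -/
theorem fFun_massOf_norm {A v : ℝ} {x : Space 3} (hA : 0 < A) (hv : v ∈ Set.Ioo (-1 : ℝ) 1)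
    (hx0 : 0 < ‖x‖) (hx : -Real.log ‖x‖ = travel A v) :
    fFun (massOf A) ‖x‖ = √(Real.sinh (-Real.log ‖x‖) / profile A (-Real.log ‖x‖)) := by
  have hn : ‖x‖ = Real.exp (-travel A v) := by
    rw [← hx, neg_neg, Real.exp_log hx0]
  conv_lhs => rw [hn]
  rw [fFun_massOf hA hv, hx, profile_travel hA]

theorem confLog_fFun {A v : ℝ} {x : Space 3} (hA : 0 < A) (hv : v ∈ Set.Ioo (-1 : ℝ) 1)
    (hx0 : 0 < ‖x‖) (hx1 : ‖x‖ < 1) (hx : -Real.log ‖x‖ = travel A v) :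
    confLog (fun y => fFun (massOf A) ‖y‖) x
      = -Real.log ‖x‖ - Real.log (profile A (-Real.log ‖x‖)) := by
  have hY := profile_pos hA hv
  rw [← hx] at hY
  have hs : 0 < -Real.log ‖x‖ := neg_pos.2 (Real.log_neg hx0 hx1)
  have hsh := Real.sinh_pos_iff.2 hs
  have hq : 0 < 1 - ‖x‖ ^ 2 := by nlinarith
  rw [confLog, fFun_massOf_norm hA hv hx0 hx, Real.log_sqrt (by positivity),
    Real.log_div hsh.ne' hY.ne']
  have h1 : Real.sinh (-Real.log ‖x‖) = ‖x‖⁻¹ * (2 / (1 - ‖x‖ ^ 2))⁻¹ := by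
    rw [Real.sinh_eq, neg_neg, Real.exp_neg, Real.exp_log hx0]
    field_simp
  rw [h1, Real.log_mul (by positivity) (by positivity), Real.log_inv, Real.log_inv]
  ring

/-! ### Behaviour at infinity -/

theorem tendsto_neg_log_norm_atInfinity :
    Tendsto (fun x : Space 3 => -Real.log ‖x‖) atInfinity (𝓝[≠] 0) := by
  have hR : Tendsto hypRadius atInfinity atTop := tendsto_comap.mono_left inf_le_left
  have hmem : ∀ᶠ x in atInfinity, x ∈ hypBall :=
    eventually_inf_principal.2 (Eventually.of_forall fun x hx => hx)
  have he : Tendsto euclRadius atTop (𝓝 1) := by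
    have h1 : Tendsto (fun ρ : ℝ => 1 - 2 * (Real.exp ρ + 1)⁻¹) atTop (𝓝 (1 - 2 * 0)) :=
      ((tendsto_inv_atTop_zero.comp
        (tendsto_atTop_add_const_right _ 1 Real.tendsto_exp_atTop)).const_mul 2).const_sub 1
    rw [mul_zero, sub_zero] at h1
    refine h1.congr fun ρ => ?_
    have := Real.exp_pos ρ
    unfold euclRadius
    field_simp
    ring
  have hn : Tendsto (fun x : Space 3 => ‖x‖) atInfinity (𝓝 1) := by
    refine (he.comp hR).congr' ?_
    filter_upwards [hmem] with x hx
    exact euclRadius_radiusOf (norm_mem_Ioo hx)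
  refine tendsto_nhdsWithin_iff.2 ⟨?_, ?_⟩
  · simpa using (hn.log one_ne_zero).neg
  · filter_upwards [hmem, hn.eventually (lt_mem_nhds zero_lt_one)] with x h1 h2
    exact (neg_pos.2 (Real.log_neg h2 (mem_hypBall.1 h1))).ne'

/-- Both functions vanish at `0` with derivative `1`, whatever the mass. -/
theorem tendsto_sinh_div_profile {A : ℝ} (hA : 0 < A) :
    Tendsto (fun s => √(Real.sinh s / profile A s)) (𝓝[≠] 0) (𝓝 1) := by
  have hp : HasDerivAt (profile A) 1 0 := by
    have := hasDerivAt_profile hA 1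
    rw [profileDeriv, travelInv_travel hA, travel_one] at this
    refine this.congr_deriv ?_
    norm_num [radialPoly]
  have hp0 : profile A 0 = 0 := by
    have := profile_travel hA 1
    rwa [travel_one, one_pow, sub_self, mul_zero] at this
  have h1 := hasDerivAt_iff_tendsto_slope_zero.1 hp
  have h2 := hasDerivAt_iff_tendsto_slope_zero.1 (Real.hasDerivAt_sinh 0)
  simp only [zero_add, hp0, Real.sinh_zero, Real.cosh_zero, sub_zero, smul_eq_mul] at h1 h2
  have h3 := (h2.div h1 one_ne_zero).sqrt
  simp only [div_one, Real.sqrt_one] at h3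
  refine h3.congr' ?_
  filter_upwards [self_mem_nhdsWithin] with s hs
  simp only [Pi.div_apply]
  rw [mul_div_mul_left _ _ (inv_ne_zero hs)]

theorem atInfinity_eventually_mem_exterior (ρ : ℝ) : ∀ᶠ x in atInfinity, x ∈ exterior ρ := by
  unfold atInfinity
  rw [eventually_inf_principal, eventually_comap]
  filter_upwards [eventually_ge_atTop ρ] with R hR x hx hxB
  exact ⟨hxB, hx ▸ hR⟩

end AdSSch

/-! ### Matching the boundary value and concluding -/

open AdSSch in
theorem mainTheorem5 (ρ₀ : ℝ) (hρ₀ : 0 < ρ₀)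
    (φ : AdSSch.Space 3 → ℝ) (g : AdSSch.MetricField 3)
    (hcont : ContinuousOn φ (AdSSch.exterior ρ₀))
    (hsmooth : ContDiffOn ℝ 2 φ (AdSSch.exteriorInterior ρ₀))
    (hg : Set.EqOn g (AdSSch.conformalMetric φ) (AdSSch.exterior ρ₀))
    (hscal : ∀ x ∈ AdSSch.exteriorInterior ρ₀, AdSSch.scalarCurvature g x = -6)
    (hlim : Filter.Tendsto φ AdSSch.atInfinity (nhds 1))
    (hgt : ∀ x ∈ AdSSch.exterior ρ₀, 1 < φ x)
    (hbdry : ∃ c : ℝ, ∀ x ∈ AdSSch.geodesicSphere ρ₀, φ x = c) :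
    ∃ M : ℝ, 0 < M ∧ AdSSch.innerRho M < ρ₀ ∧
      Set.EqOn g (AdSSch.adsSchMetric M) (AdSSch.exterior ρ₀) := by
  obtain ⟨c, hc⟩ := hbdry
  have hτ := euclRadius_pos hρ₀
  have hτ1 := (euclRadius_mem ρ₀).2
  have hc1 : 1 < c := by
    have hn : ‖(EuclideanSpace.single 0 (euclRadius ρ₀) : Space 3)‖ = euclRadius ρ₀ := by
      simp [abs_of_pos hτ]
    have hx : EuclideanSpace.single 0 (euclRadius ρ₀) ∈ geodesicSphere ρ₀ := by
      refine ⟨mem_hypBall.2 (hn.symm ▸ hτ1), ?_⟩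
      rw [hypRadius, hn, radiusOf_euclRadius]
    rw [← hc _ hx]
    exact hgt _ ⟨hx.1, hx.2.ge⟩
  set s₀ := -Real.log (euclRadius ρ₀) with hs₀
  have hs₀pos : 0 < s₀ := neg_pos.2 (Real.log_neg hτ hτ1)
  have hsh := Real.sinh_pos_iff.2 hs₀pos
  have hc2 : 1 < c ^ 2 := by nlinarith
  -- The factor is `√(sinh s₀ / Y)`, so `Y = sinh s₀ / c²` makes it `c`; `c > 1` puts this value
  -- below the hyperbolic one.
  obtain ⟨A, v₀, hA, hv₀, hAs, hAy⟩ := exists_travel_eq hs₀pos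
    (show 0 < Real.sinh s₀ / c ^ 2 by positivity) (div_lt_self hsh hc2)
  have hρ : euclRadius ρ₀ = Real.exp (-travel A v₀) := by
    rw [hAs, hs₀, neg_neg, Real.exp_log hτ]
  set ψ : Space 3 → ℝ := fun x => fFun (massOf A) ‖x‖ with hψ
  have htr : ∀ x ∈ exterior ρ₀, 0 < ‖x‖ ∧ ∃ v ∈ Set.Ioo (-1 : ℝ) 1,
      -Real.log ‖x‖ = travel A v := by
    intro x hx
    obtain ⟨h1, v, h2, h3⟩ := exists_travel_eq_of_mem_exterior hv₀.2 hρ hx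
    exact ⟨h1, v, ⟨hv₀.1.trans_le h2.1, h2.2⟩, h3⟩
  have hψeq : ∀ x ∈ exterior ρ₀,
      ψ x = √(Real.sinh (-Real.log ‖x‖) / profile A (-Real.log ‖x‖)) := by
    intro x hx
    obtain ⟨h1, v, h2, h3⟩ := htr x hx
    exact fFun_massOf_norm hA h2 h1 h3
  have hψpos : ∀ x ∈ exterior ρ₀, 0 < ψ x := by
    intro x hx
    obtain ⟨h1, v, h2, h3⟩ := htr x hx
    rw [hψeq x hx]
    refine Real.sqrt_pos.2 (div_pos (Real.sinh_pos_iff.2 (neg_pos.2 (Real.log_neg h1 ?_))) ?_)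
    · exact (mem_exterior.1 hx).2
    · exact h3 ▸ profile_pos hA h2
  have hψcont : ContinuousOn ψ (exterior ρ₀) := by
    refine ContinuousOn.congr (fun x hx => ContinuousAt.continuousWithinAt ?_) hψeq
    obtain ⟨h1, v, h2, h3⟩ := htr x hx
    have hl : ContinuousAt (fun x : Space 3 => -Real.log ‖x‖) x :=
      (continuous_norm.continuousAt.log h1.ne').neg
    have hp : ContinuousAt (profile A) (-Real.log ‖x‖) :=
      h3 ▸ (hasDerivAt_profile hA v).continuousAt
    refine ContinuousAt.sqrt ?_
    refine (Real.continuous_sinh.continuousAt.comp hl).div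
      (ContinuousAt.comp (f := fun x : Space 3 => -Real.log ‖x‖) hp hl) ?_
    exact h3 ▸ (profile_pos hA h2).ne'
  have hψev : ∀ x ∈ exteriorInterior ρ₀,
      (fun y : Space 3 => -Real.log ‖y‖ - Real.log (profile A (-Real.log ‖y‖)))
        =ᶠ[𝓝 x] confLog ψ := by
    intro x hx
    filter_upwards [(isOpen_exteriorInterior ρ₀).mem_nhds hx] with y hy
    obtain ⟨h1, v, h2, h3⟩ := htr y (exteriorInterior_subset _ hy)
    exact (confLog_fFun hA h2 h1 (mem_exteriorInterior.1 hy).2 h3).symm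
  have hψsol : ∀ x ∈ exteriorInterior ρ₀,
      TwiceDiffAt (confLog ψ) x ∧ SolvesLiouville (confLog ψ) x := by
    intro x hx
    obtain ⟨h1, v, h2, h3⟩ := htr x (exteriorInterior_subset _ hx)
    obtain ⟨h4, h5⟩ := solvesLiouville_profile hA h2 h3 (norm_pos_iff.1 h1)
    exact ⟨h4.congr (hψev x hx), h5.congr (hψev x hx)⟩
  have hψlim : Tendsto ψ atInfinity (𝓝 1) := by
    refine ((tendsto_sinh_div_profile hA).comp tendsto_neg_log_norm_atInfinity).congr' ?_
    filter_upwards [atInfinity_eventually_mem_exterior ρ₀] with x hx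
    exact (hψeq x hx).symm
  have hbd : ∀ x ∈ geodesicSphere ρ₀, φ x = ψ x := by
    intro x hx
    have hxn : ‖x‖ = euclRadius ρ₀ := by
      rw [← hx.2]
      exact (euclRadius_radiusOf (norm_mem_Ioo hx.1)).symm
    rw [hc x hx, hψeq x ⟨hx.1, hx.2.ge⟩, hxn, ← hs₀]
    conv_rhs => rw [← hAs, profile_travel hA, hAs, hAy]
    rw [div_div_cancel₀ hsh.ne', Real.sqrt_sq (by linarith)]
  have hφpos : ∀ x ∈ exterior ρ₀, 0 < φ x := fun x hx => zero_lt_one.trans (hgt x hx)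
  have hφd : ∀ x ∈ exteriorInterior ρ₀, TwiceDiffAt (confLog φ) x := fun x hx =>
    twiceDiffAt_confLog (hsmooth.contDiffAt ((isOpen_exteriorInterior ρ₀).mem_nhds hx))
      (hφpos x (exteriorInterior_subset _ hx)) (mem_exteriorInterior.1 hx).2
  have hφs : ∀ x ∈ exteriorInterior ρ₀, SolvesLiouville (confLog φ) x := fun x hx =>
    solvesLiouville_confLog (hg.mono (exteriorInterior_subset _)) hx
      (fun y hy => hφpos y (exteriorInterior_subset _ hy)) (hφd x hx) (hscal x hx)
  refine ⟨massOf A, massOf_pos hA, innerRho_massOf_lt hA hv₀.1 hρ, fun x hx => ?_⟩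
  have hle := le_of_solvesLiouville hcont hψcont hφpos hψpos hφd (fun x hx => (hψsol x hx).1)
    hφs (fun x hx => (hψsol x hx).2) hbd hlim hψlim x hx
  have hge := le_of_solvesLiouville hψcont hcont hψpos hφpos (fun x hx => (hψsol x hx).1) hφd
    (fun x hx => (hψsol x hx).2) hφs (fun x hx => (hbd x hx).symm) hψlim hlim x hx
  have heq : φ x = fFun (massOf A) ‖x‖ := le_antisymm hle hge
  rw [hg hx, adsSchMetric, conformalMetric, conformalMetric, heq]
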